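/- Let $U,V\subset\mathbb R$ be nonempty open intervals and $\Omega=\{(u,v)\in U\times V:\ u\neq v\}$. Consider on $\Omega$ the Chaplygin/Born–Infeld system $$u_t=v\,u_x,\qquad v_t=u\,v_x .\tag{1}$$ For smooth nowhere vanishing functions $f$ on $U$ and $\varphi$ on $V$ put $$w^1=\tfrac12\big[(u-v)f'(u)-f(u)-\varphi(v)\big],\qquad w^2=\tfrac12\big[(v-u)\varphi'(v)-f(u)-\varphi(v)\big],$$ $$J_{f,\varphi}=(u-v)^2\begin{pmatrix}f(u)&0\\0&\varphi(v)\end{pmatrix}\frac{d}{dx}+(u-v)\begin{pmatrix}\frac12(u-v)f'(u)u_x+f(u)(u_x-v_x)&\varphi(v)u_x+f(u)v_x\\-\varphi(v)u_x-f(u)v_x&\frac12(u-v)\varphi'(v)v_x+\varphi(v)(u_x-v_x)\end{pmatrix}$$ $$\qquad+\begin{pmatrix}w^1u_x&u_x\\w^2v_x&v_x\end{pmatrix}\Big(\frac d{dx}\Big)^{-1}\begin{pmatrix}u_x&v_x\\w^1u_x&w^2v_x\end{pmatrix}.$$ Acting on smooth compactly supported covector fields, $(d/dx)^{-1}$ is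 the skew-symmetric antiderivative with kernel $\frac12\operatorname{sgn}(x-y)$. An operator $J$ is called Hamiltonian if for all smooth fields $x\mapsto(u(x),v(x))\in\Omega$ it maps smooth compactly supported covector fields linearly to smooth vector fields, is skew-symmetric, and the bracket $\{A,B\}=\int\frac{\delta A}{\delta u^i}J^{ij}\frac{\delta B}{\delta u^j}\,dx$ satisfies the Jacobi identity $\{\{A,B\},C\}+\{\{B,C\},A\}+\{\{C,A\},B\}=0$ for all linear functionals $A=\int a_i(x)u^i(x)\,dx$, etc., with $a,b,c$ smooth and compactly supported. It is local if $(Ja)(x)$ vanishes whenever $a$ vanishes near $x$. Then: 1. For all such $f,\varphi$: (a) the local part of $J_{f,\varphi}$ has the form $g^{ij}\frac d{dx}-g^{is}\Gamma^j_{sk}u^k_x$, where $\Gamma$ is the Levi-Civita connection of the metric $(u-v)^{-2}\big(\frac{du^2}{f(u)}+\frac{dv^2}{\varphi(v)}\big)$; (b) $J_{f,\varphi}$ is a Hamiltonian operator; (c) $u_\tau=w^1u_x,\ v_\tau=w^2v_x$ commutes with (1); (d) system (1) is Hamiltonian, $(u,v)^T_t=J_{f,\varphi}(\partial\tilde h/\partial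 u,\partial\tilde h/\partial v)^T$, with density $$\tilde h=\frac1{4(v-u)}\Big(\Big[\int^u\frac{d\nu}{\sqrt{f(\nu)}}\Big]^2-\Big[\int^v\frac{d\nu}{\sqrt{\varphi(\nu)}}\Big]^2\Big),$$ for any choice of the antiderivatives. Here, if $f<0$, $[\int d\nu/\sqrt f]^2$ stands for $-[\int d\nu/\sqrt{|f|}]^2$ (likewise for $\varphi$), and, in this equation, each $(d/dx)^{-1}$ is a formal antiderivative: for a suitable choice of constants, a function of $(u,v)$ whose total $x$-derivative is the given expression along every smooth field in $\Omega$; (e) $J_{f,\varphi}$ is local if and only if $w^1=w^2=0$ on $\Omega$. 2. All these operators are mutually compatible: every linear combination $c_1J_{f_1,\varphi_1}+c_2J_{f_2,\varphi_2}$ with real $c_1,c_2$ is Hamiltonian. 3. Different pairs $(f,\varphi)$ define different operators, and infinitely many of the operators are nonlocal. 4. The flows in 1(c) are the general commuting flow of (1): if $U\cap V=\emptyset$, every system $u^i_\tau=W^i_j(u,v)\,u^j_x$ ($i=1,2$, $(u^1,u^2)=(u,v)$) with smooth $W$ on $\Omega$ that commutes with (1) is of the form $u_\tau=w^1u_x,\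 v_\tau=w^2v_x$ for some smooth functions $f$ on $U$ and $\varphi$ on $V$ (zeros allowed). -/

import Mathlib

open scoped ContDiff Matrix Topology

noncomputable section

/-! ## Fields, test covectors, flows of hydrodynamic type -/

/-- A smooth field `x ↦ u(x)` with values in the domain `Ω` of the space of dependent variables. -/
def IsSmoothField {n : ℕ} (Ω : Set (Fin n → ℝ)) (u : ℝ → Fin n → ℝ) : Prop :=
  ContDiff ℝ ∞ u ∧ ∀ x, u x ∈ Ω

/-- A smooth compactly supported covector field `x ↦ a(x)`, i.e. the differential of the linear
functional `u ↦ ∫ aᵢ(x) uⁱ(x) dx`. -/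
def IsTestCovector {n : ℕ} (a : ℝ → Fin n → ℝ) : Prop :=
  ContDiff ℝ ∞ a ∧ HasCompactSupport a

/-- The right-hand side `u ↦ V(u) uₓ` of the system of hydrodynamic type `uₜ = V(u) uₓ`. -/
def hydroFlow {n : ℕ} (V : (Fin n → ℝ) → Matrix (Fin n) (Fin n) ℝ)
    (u : ℝ → Fin n → ℝ) (x : ℝ) : Fin n → ℝ :=
  V (u x) *ᵥ deriv u x

/-- The systems `uₜ = V(u) uₓ` and `u_τ = W(u) uₓ` commute on `Ω`: the commutator of the two
evolutionary vector fields vanishes, that is, the derivative of either right-hand side in the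
direction of the other one is the same. -/
def FlowsCommute {n : ℕ} (Ω : Set (Fin n → ℝ))
    (V W : (Fin n → ℝ) → Matrix (Fin n) (Fin n) ℝ) : Prop :=
  ∀ u, IsSmoothField Ω u → ∀ x, ∃ d : Fin n → ℝ,
    HasDerivAt (fun s : ℝ => hydroFlow V (u + s • hydroFlow W u) x) d 0 ∧
    HasDerivAt (fun s : ℝ => hydroFlow W (u + s • hydroFlow V u) x) d 0

/-! ## Hamiltonian operators -/

/-- A (field dependent, possibly nonlocal) operator `a ↦ J_u a` from covector fields to
vector fields. -/
abbrev FieldOperator (n : ℕ) : Type :=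
  (ℝ → Fin n → ℝ) → (ℝ → Fin n → ℝ) → ℝ → Fin n → ℝ

/-- The bracket `∫ aᵢ J^{ij} bⱼ dx` of the linear functionals with differentials `a` and `b`, as a
functional of the field `u`. -/
def linBracket {n : ℕ} (J : FieldOperator n) (a b : ℝ → Fin n → ℝ) (u : ℝ → Fin n → ℝ) : ℝ :=
  ∫ x, a x ⬝ᵥ J u b x

/-- `J` is a Hamiltonian operator on fields with values in `Ω`: it is a linear operator which is
skew-symmetric, and the bracket `{A, B} = ∫ (δA/δuⁱ) J^{ij} (δB/δuʲ) dx` satisfies the Jacobi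
identity. Both conditions are tested on linear functionals: since the functional `{A, B}` has the
derivative `{{A, B}, C}` in the direction `J_u c`, Jacobi's identity is
`∑_cyc D({A, B})_u [J_u c] = 0`. -/
structure IsHamiltonianOperator {n : ℕ} (Ω : Set (Fin n → ℝ)) (J : FieldOperator n) : Prop where
  smooth : ∀ u a, IsSmoothField Ω u → IsTestCovector a → ContDiff ℝ ∞ (J u a)
  map_add : ∀ u a b, IsSmoothField Ω u → IsTestCovector a → IsTestCovector b →
    J u (a + b) = J u a + J u b
  map_smul : ∀ u a, ∀ r : ℝ, IsSmoothField Ω u → IsTestCovector a → J u (r • a) = r • J u a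
  skew : ∀ u a b, IsSmoothField Ω u → IsTestCovector a → IsTestCovector b →
    linBracket J a b u = - linBracket J b a u
  jacobi : ∀ u a b c, IsSmoothField Ω u → IsTestCovector a → IsTestCovector b → IsTestCovector c →
    ∃ d₁ d₂ d₃ : ℝ,
      HasDerivAt (fun s : ℝ => linBracket J a b (u + s • J u c)) d₁ 0 ∧
      HasDerivAt (fun s : ℝ => linBracket J b c (u + s • J u a)) d₂ 0 ∧
      HasDerivAt (fun s : ℝ => linBracket J c a (u + s • J u b)) d₃ 0 ∧
      d₁ + d₂ + d₃ = 0

/-- Two Hamiltonian operators are compatible if all their linear combinations are Hamiltonian. -/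
def Compatible {n : ℕ} (Ω : Set (Fin n → ℝ)) (J₁ J₂ : FieldOperator n) : Prop :=
  ∀ c₁ c₂ : ℝ, IsHamiltonianOperator Ω (c₁ • J₁ + c₂ • J₂)

/-- Two operators coincide on all fields with values in `Ω`. -/
def SameOperatorOn {n : ℕ} (Ω : Set (Fin n → ℝ)) (J₁ J₂ : FieldOperator n) : Prop :=
  ∀ u a, IsSmoothField Ω u → IsTestCovector a → J₁ u a = J₂ u a

/-- The operator is local: `(J_u a)(x)` depends only on the germ of `a` at `x`. -/
def IsLocalOperator {n : ℕ} (Ω : Set (Fin n → ℝ)) (J : FieldOperator n) : Prop :=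
  ∀ u a x, IsSmoothField Ω u → IsTestCovector a → a =ᶠ[𝓝 x] 0 → J u a x = 0

/-! ## Nonlocal operators of hydrodynamic type -/

/-- The skew-symmetric inverse of `d/dx`, with kernel `½ sgn(x - y)`. -/
def invD (p : ℝ → ℝ) (x : ℝ) : ℝ :=
  (1 / 2) * ((∫ y in Set.Iic x, p y) - ∫ y in Set.Ioi x, p y)

/-- The data of an operator
`J = lead(u) d/dx + coef(u, uₓ) + left(u, uₓ) (d/dx)⁻¹ right(u, uₓ)`
in `n` dependent variables, with a nonlocal tail of `m` terms. -/
structure HydroOperator (n m : ℕ) where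
  lead : (Fin n → ℝ) → Matrix (Fin n) (Fin n) ℝ
  coef : (Fin n → ℝ) → (Fin n → ℝ) → Matrix (Fin n) (Fin n) ℝ
  left : (Fin n → ℝ) → (Fin n → ℝ) → Matrix (Fin n) (Fin m) ℝ
  right : (Fin n → ℝ) → (Fin n → ℝ) → Matrix (Fin m) (Fin n) ℝ

/-- The action on covector fields. -/
def HydroOperator.toFieldOperator {n m : ℕ} (J : HydroOperator n m) : FieldOperator n :=
  fun u a x =>
    J.lead (u x) *ᵥ deriv a x + J.coef (u x) (deriv u x) *ᵥ a x +
      J.left (u x) (deriv u x) *ᵥ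
        fun k => invD (fun y => (J.right (u y) (deriv u y) *ᵥ a y) k) x

/-- The partial derivative `∂f/∂uⁱ`. -/
def pderiv {n : ℕ} (i : Fin n) (f : (Fin n → ℝ) → ℝ) (p : Fin n → ℝ) : ℝ :=
  fderiv ℝ f p (Pi.single i 1)

/-- The covector `(∂h/∂u¹, …, ∂h/∂uⁿ)`. -/
def grad {n : ℕ} (h : (Fin n → ℝ) → ℝ) (p : Fin n → ℝ) : Fin n → ℝ :=
  fun i => pderiv i h p

/-- On `Ω` the system `uₜ = V(u) uₓ` is Hamiltonian, `uₜ = J (∂h/∂u)`, with the operator `J` and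
the density `h(u)`. In `J (∂h/∂u)` each expression `(d/dx)⁻¹ (right(u, uₓ) ∂h/∂u)ₖ` is a formal
antiderivative: a function `Q k` of the dependent variables whose total `x`-derivative is
`(right(u, uₓ) ∂h/∂u)ₖ` along every field. -/
def IsHamiltonianSystem {n m : ℕ} (Ω : Set (Fin n → ℝ)) (J : HydroOperator n m)
    (h : (Fin n → ℝ) → ℝ) (V : (Fin n → ℝ) → Matrix (Fin n) (Fin n) ℝ) : Prop :=
  ContDiffOn ℝ ∞ h Ω ∧
  ∃ Q : Fin m → (Fin n → ℝ) → ℝ, ∀ u, IsSmoothField Ω u → ∀ x,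
    (∀ k, HasDerivAt (fun y => Q k (u y))
      ((J.right (u x) (deriv u x) *ᵥ grad h (u x)) k) x) ∧
    hydroFlow V u x =
      J.lead (u x) *ᵥ deriv (fun y => grad h (u y)) x +
        J.coef (u x) (deriv u x) *ᵥ grad h (u x) +
        J.left (u x) (deriv u x) *ᵥ fun k => Q k (u x)

/-- Christoffel symbols `Γᵏᵢⱼ` of the Levi-Civita connection of the (pseudo-Riemannian)
metric `g`. -/
def christoffel {n : ℕ} (g : (Fin n → ℝ) → Matrix (Fin n) (Fin n) ℝ) (p : Fin n → ℝ)
    (k i j : Fin n) : ℝ :=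
  (1 / 2) * ∑ l, (g p)⁻¹ k l *
    (pderiv i (fun q => g q l j) p + pderiv j (fun q => g q l i) p - pderiv l (fun q => g q i j) p)

/-- The local part of `J` is `g^{ij} d/dx - g^{is} Γʲₛₖ uₓᵏ`, where `g` is a nondegenerate symmetric
metric on `Ω` and `Γ` is its Levi-Civita connection. -/
def LocalPartOfMetric {n m : ℕ} (Ω : Set (Fin n → ℝ)) (J : HydroOperator n m)
    (g : (Fin n → ℝ) → Matrix (Fin n) (Fin n) ℝ) : Prop :=
  ∀ p ∈ Ω, (g p).IsSymm ∧ (g p).det ≠ 0 ∧ J.lead p = (g p)⁻¹ ∧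
    ∀ (ξ : Fin n → ℝ) (i j : Fin n),
      J.coef p ξ i j = - ∑ s, ∑ k, (g p)⁻¹ i s * christoffel g p j s k * ξ k

/-! ## The system `uₜ = v uₓ`, `vₜ = u vₓ`; here `p 0 = u` and `p 1 = v` -/

/-- The part of `U × V` off the diagonal `u = v`. -/
def offDiagonal (U V : Set ℝ) : Set (Fin 2 → ℝ) :=
  {p | p 0 ∈ U ∧ p 1 ∈ V ∧ p 0 ≠ p 1}

/-- The matrix of the system `uₜ = v uₓ`, `vₜ = u vₓ`. -/
def chaplyginMatrix (p : Fin 2 → ℝ) : Matrix (Fin 2) (Fin 2) ℝ :=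
  !![p 1, 0; 0, p 0]

/-- The parameter functions: smooth and nowhere zero. -/
def Admissible (U : Set ℝ) (f : ℝ → ℝ) : Prop :=
  ContDiffOn ℝ ∞ f U ∧ ∀ t ∈ U, f t ≠ 0

/-- `w¹ = ½ [(u - v) f'(u) - f(u) - φ(v)]`. -/
def speed₁ (f φ : ℝ → ℝ) (p : Fin 2 → ℝ) : ℝ :=
  (1 / 2) * ((p 0 - p 1) * deriv f (p 0) - f (p 0) - φ (p 1))

/-- `w² = ½ [(v - u) φ'(v) - f(u) - φ(v)]`. -/
def speed₂ (f φ : ℝ → ℝ) (p : Fin 2 → ℝ) : ℝ :=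
  (1 / 2) * ((p 1 - p 0) * deriv φ (p 1) - f (p 0) - φ (p 1))

/-- The matrix of the system `u_τ = w¹ uₓ`, `v_τ = w² vₓ`. -/
def speedMatrix (f φ : ℝ → ℝ) (p : Fin 2 → ℝ) : Matrix (Fin 2) (Fin 2) ℝ :=
  !![speed₁ f φ p, 0; 0, speed₂ f φ p]

/-- The metric `(u - v)⁻² (du² / f(u) + dv² / φ(v))`. -/
def chaplyginMetric (f φ : ℝ → ℝ) (p : Fin 2 → ℝ) : Matrix (Fin 2) (Fin 2) ℝ :=
  !![1 / ((p 0 - p 1) ^ 2 * f (p 0)), 0; 0, 1 / ((p 0 - p 1) ^ 2 * φ (p 1))]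

/-- The nonlocal operator with parameters `f` and `φ`; here `ξ 0 = uₓ` and `ξ 1 = vₓ`. -/
def chaplyginOperator (f φ : ℝ → ℝ) : HydroOperator 2 2 where
  lead p := (p 0 - p 1) ^ 2 • !![f (p 0), 0; 0, φ (p 1)]
  coef p ξ := (p 0 - p 1) •
    !![(1 / 2) * (p 0 - p 1) * deriv f (p 0) * ξ 0 + f (p 0) * (ξ 0 - ξ 1),
        φ (p 1) * ξ 0 + f (p 0) * ξ 1;
      - φ (p 1) * ξ 0 - f (p 0) * ξ 1,
        (1 / 2) * (p 0 - p 1) * deriv φ (p 1) * ξ 1 + φ (p 1) * (ξ 0 - ξ 1)]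
  left p ξ := !![speed₁ f φ p * ξ 0, ξ 0; speed₂ f φ p * ξ 1, ξ 1]
  right p ξ := !![ξ 0, ξ 1; speed₁ f φ p * ξ 0, speed₂ f φ p * ξ 1]

/-- `F` is an antiderivative of `1 / √|f|` on `U`. -/
def IsRootPrimitive (U : Set ℝ) (f F : ℝ → ℝ) : Prop :=
  ∀ t ∈ U, HasDerivAt F (1 / √|f t|) t

/-- The density `([∫ du/√f]² - [∫ dv/√φ]²) / (4 (v - u))`, in terms of antiderivatives `F` of
`1 / √|f|` and `Φ` of `1 / √|φ|`. Where `f < 0`, one has `√f = i √|f|`, so that the square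
`[∫ du/√f]²` is the real number `- F²`; similarly for `φ`. -/
def chaplyginDensity (f φ F Φ : ℝ → ℝ) (p : Fin 2 → ℝ) : ℝ :=
  (Real.sign (f (p 0)) * F (p 0) ^ 2 - Real.sign (φ (p 1)) * Φ (p 1) ^ 2) /
    (4 * (p 1 - p 0))

end

/-!
Integration by parts turns the bracket of two linear functionals into an integral of a density in
which the tail appears only as `S_a (d/dx)⁻¹ T_b - (d/dx)⁻¹ T_a S_b`, with `T_a = uₓ a₀ + vₓ a₁`
and `S_a = w¹ uₓ a₀ + w² vₓ a₁`. This makes skew symmetry obvious and gives the variational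
derivative of the bracket in closed form; paired with `J_u c` and summed cyclically, it vanishes
pointwise, as a polynomial identity in the jets and in the values of `(d/dx)⁻¹`. No condition on `f`
and `φ` is needed, and `J` depends linearly on `(f, φ)`, so linear combinations are Hamiltonian too.
Since `J_u c` is not compactly supported, `u + s J_u c` may leave `Ω` for every `s ≠ 0`; as the
bracket only sees the germ of the field along the supports, the variation may be cut off.

The density satisfies its equations because `G = [∫ du/√f]²` solves `f G'' + f' G' / 2 = 2`.

Flows commute with the system if and only if their matrix is diagonal and its entries satisfy
`(u - v) ∂ᵥw¹ = w² - w¹ = (u - v) ∂ᵤw²`. A solution of this system is determined by `w¹` on a line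
`u = u₀` and `w²` on a line `v = v₀`, and the speeds of suitable `f` and `φ` realize all such data.

If `J` is local, testing it with covectors supported to the right of `x` gives
`wⁱ(u(x)) + wⁱ(u(y)) = 0` for `x < y` whenever `uⁱₓ` vanishes neither at `x` nor at `y`; a field
with `u(x) = u(y)` then yields `wⁱ = 0`.
-/

open MeasureTheory Filter

section Primitive

variable {p q : ℝ → ℝ}

theorem invD_eq_integral_Iic_sub (hp : Integrable p) (x : ℝ) :
    invD p x = (∫ y in Set.Iic x, p y) - (1 / 2) * ∫ y, p y := by
  rw [invD, ← intervalIntegral.integral_Iic_add_Ioi (b := x) hp.integrableOn hp.integrableOn]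
  ring

theorem invD_eq_sub_integral_Ioi (hp : Integrable p) (x : ℝ) :
    invD p x = (1 / 2) * (∫ y, p y) - ∫ y in Set.Ioi x, p y := by
  rw [invD, ← intervalIntegral.integral_Iic_add_Ioi (b := x) hp.integrableOn hp.integrableOn]
  ring

theorem tendsto_invD_atBot (hp : Integrable p) :
    Tendsto (invD p) atBot (𝓝 (-((1 / 2) * ∫ y, p y))) := by
  rw [funext (invD_eq_integral_Iic_sub hp), ← zero_sub]
  exact (tendsto_integral_Iic_zero tendsto_id).sub_const _

theorem tendsto_invD_atTop (hp : Integrable p) :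
    Tendsto (invD p) atTop (𝓝 ((1 / 2) * ∫ y, p y)) := by
  rw [funext (invD_eq_sub_integral_Ioi hp)]
  simpa using (tendsto_integral_Ioi_zero tendsto_id).const_sub ((1 / 2) * ∫ y, p y)

theorem hasDerivAt_invD (hp : Continuous p) (hi : Integrable p) (x : ℝ) :
    HasDerivAt (invD p) (p x) x := by
  have h : invD p = fun x => (∫ y in (0 : ℝ)..x, p y) +
      ((∫ y in Set.Iic 0, p y) - (1 / 2) * ∫ y, p y) := by
    ext x
    rw [invD_eq_integral_Iic_sub hi,
      ← intervalIntegral.integral_Iic_sub_Iic hi.integrableOn hi.integrableOn]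
    ring
  rw [h]
  exact (hp.integral_hasStrictDerivAt 0 x).hasDerivAt.add_const _

theorem contDiff_invD (hp : ContDiff ℝ ∞ p) (hi : Integrable p) : ContDiff ℝ ∞ (invD p) := by
  have h := hasDerivAt_invD hp.continuous hi
  rw [contDiff_infty_iff_deriv, funext fun x => (h x).deriv]
  exact ⟨fun x => (h x).differentiableAt, hp⟩

theorem invD_add (hp : Integrable p) (hq : Integrable q) : invD (p + q) = invD p + invD q := by
  ext x
  simp only [invD, Pi.add_apply, integral_add hp.integrableOn hq.integrableOn]
  ring

theorem invD_smul (r : ℝ) (p : ℝ → ℝ) : invD (r • p) = r • invD p := by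
  ext x
  simp only [invD, Pi.smul_apply, smul_eq_mul, integral_const_mul]
  ring

theorem integral_mul_invD_add_invD_mul (hp : Continuous p) (hpi : Integrable p)
    (hq : Continuous q) (hqi : Integrable q)
    (hi : Integrable fun x => p x * invD q x + invD p x * q x) :
    ∫ x, (p x * invD q x + invD p x * q x) = 0 := by
  have h := integral_of_hasDerivAt_of_tendsto
    (fun x => (hasDerivAt_invD hp hpi x).mul (hasDerivAt_invD hq hqi x)) hi
    ((tendsto_invD_atBot hpi).mul (tendsto_invD_atBot hqi))
    ((tendsto_invD_atTop hpi).mul (tendsto_invD_atTop hqi))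
  rw [h]
  ring

end Primitive

section ParametricIntegral

variable {G : ℝ → ℝ → ℝ} {K : Set ℝ}

theorem contDiffAt_of_vanishing (hK : IsClosed K) (hG : ∀ s, ∀ x ∉ K, G s x = 0) (s : ℝ) {x : ℝ}
    (hx : x ∉ K) : ContDiffAt ℝ 1 (fun z : ℝ × ℝ => G z.1 z.2) (s, x) := by
  refine (contDiffAt_const (c := (0 : ℝ))).congr_of_eventuallyEq ?_
  filter_upwards [continuous_snd.continuousAt.preimage_mem_nhds (hK.isOpen_compl.mem_nhds hx)]
    with z hz using hG z.1 z.2 hz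

theorem hasDerivAt_fst_of_contDiffAt {s x : ℝ}
    (h : ContDiffAt ℝ 1 (fun z : ℝ × ℝ => G z.1 z.2) (s, x)) :
    HasDerivAt (fun s => G s x) (fderiv ℝ (fun z : ℝ × ℝ => G z.1 z.2) (s, x) (1, 0)) s :=
  (h.differentiableAt one_ne_zero).hasFDerivAt.comp_hasDerivAt (f := fun s => (s, x)) s
    ((hasDerivAt_id s).prodMk (hasDerivAt_const s x))

theorem integrable_of_contDiffAt {s : ℝ} (hK : IsCompact K) (hG : ∀ s, ∀ x ∉ K, G s x = 0)
    (hs : ∀ x ∈ K, ContDiffAt ℝ 1 (fun z : ℝ × ℝ => G z.1 z.2) (s, x)) : Integrable (G s) := by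
  refine Continuous.integrable_of_hasCompactSupport (continuous_iff_continuousAt.2 fun x => ?_)
    (HasCompactSupport.intro hK (hG s))
  have h : ContDiffAt ℝ 1 (fun z : ℝ × ℝ => G z.1 z.2) (s, x) := by
    by_cases hx : x ∈ K
    exacts [hs x hx, contDiffAt_of_vanishing hK.isClosed hG s hx]
  exact h.continuousAt.comp (f := fun y => (s, y)) (by fun_prop)

theorem hasDerivAt_integral_of_contDiffAt {G' : ℝ → ℝ} (hK : IsCompact K)
    (hG₀ : ∀ s, ∀ x ∉ K, G s x = 0)
    (hG : ∀ x ∈ K, ContDiffAt ℝ 1 (fun z : ℝ × ℝ => G z.1 z.2) (0, x))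
    (hG' : ∀ x, HasDerivAt (fun s => G s x) (G' x) 0) :
    HasDerivAt (fun s => ∫ x, G s x) (∫ x, G' x) 0 := by
  have smooth_off_K (s : ℝ) {x : ℝ} (hx : x ∉ K) := contDiffAt_of_vanishing hK.isClosed hG₀ s hx
  set g : ℝ × ℝ → ℝ := fun z => G z.1 z.2
  set D : ℝ → ℝ → ℝ := fun s x => fderiv ℝ g (s, x) (1, 0)
  have continuousAt_D {s x : ℝ} (h : ContDiffAt ℝ 1 g (s, x)) :
      ContinuousAt (fun z : ℝ × ℝ => D z.1 z.2) (s, x) :=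
    (h.continuousAt_fderiv one_ne_zero).clm_apply continuousAt_const
  have smooth_at_zero (x : ℝ) : ContDiffAt ℝ 1 g (0, x) := by
    by_cases hx : x ∈ K
    exacts [hG x hx, smooth_off_K 0 hx]
  have continuous_D_zero : Continuous (D 0) := continuous_iff_continuousAt.2 fun x =>
    (continuousAt_D (smooth_at_zero x)).comp (f := fun y => ((0 : ℝ), y)) (by fun_prop)
  obtain ⟨C, hC⟩ := hK.exists_bound_of_continuousOn continuous_D_zero.continuousOn
  have near_zero : ∀ᶠ s in 𝓝 (0 : ℝ), ∀ x ∈ K, ContDiffAt ℝ 1 g (s, x) ∧ ‖D s x‖ < C + 1 :=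
    hK.eventually_forall_of_forall_eventually fun x hx =>
      ((hG x hx).eventually (by simp)).and <|
        (continuousAt_D (hG x hx)).norm.eventually_lt_const ((hC x hx).trans_lt (lt_add_one C))
  rw [funext fun x => (hG' x).unique (hasDerivAt_fst_of_contDiffAt (smooth_at_zero x))]
  refine (hasDerivAt_integral_of_dominated_loc_of_deriv_le (F := G) (F' := D)
    (bound := K.indicator fun _ => C + 1) near_zero
    (near_zero.mono fun s hs =>
      (integrable_of_contDiffAt hK hG₀ fun x hx => (hs x hx).1).aestronglyMeasurable)
    (integrable_of_contDiffAt hK hG₀ hG) continuous_D_zero.aestronglyMeasurable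
    (Eventually.of_forall fun x s hs => ?_)
    ((integrable_indicator_iff hK.measurableSet).2 (integrableOn_const hK.measure_lt_top.ne))
    (Eventually.of_forall fun x s hs => ?_)).2
  · by_cases hx : x ∈ K
    · rw [Set.indicator_of_mem hx]
      exact (hs x hx).2.le
    · have hD : D s x = 0 := (hasDerivAt_fst_of_contDiffAt (smooth_off_K s hx)).unique
        (by simpa only [hG₀ _ x hx] using hasDerivAt_const s (0 : ℝ))
      simp [Set.indicator_of_notMem hx, hD]
  · by_cases hx : x ∈ K
    exacts [hasDerivAt_fst_of_contDiffAt (hs x hx).1,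
      hasDerivAt_fst_of_contDiffAt (smooth_off_K s hx)]

end ParametricIntegral

section TestCovectors

variable {n : ℕ} {Ω : Set (Fin n → ℝ)} {u X a : ℝ → Fin n → ℝ}

theorem deriv_eq_zero_of_notMem_tsupport {x : ℝ} (hx : x ∉ tsupport a) : deriv a x = 0 :=
  image_eq_zero_of_notMem_tsupport fun h => hx (tsupport_deriv_subset h)

theorem deriv_add_smul (hu : ContDiff ℝ ∞ u) (hX : ContDiff ℝ ∞ X) (s x : ℝ) :
    deriv (u + s • X) x = deriv u x + s • deriv X x := by
  rw [deriv_add (hu.differentiable (by simp) x) ((hX.differentiable (by simp) x).const_smul s),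
    deriv_const_smul _ (hX.differentiable (by simp) x)]

theorem IsSmoothField.eventually_add_smul (hΩ : IsOpen Ω) (hu : IsSmoothField Ω u)
    (hX : IsTestCovector X) : ∀ᶠ s in 𝓝 (0 : ℝ), IsSmoothField Ω (u + s • X) := by
  have hmem : ∀ᶠ s in 𝓝 (0 : ℝ), ∀ x ∈ tsupport X, (u + s • X) x ∈ Ω := by
    refine hX.2.eventually_forall_of_forall_eventually fun x _ => ?_
    have h : Continuous fun z : ℝ × ℝ => (u + z.1 • X) z.2 := by
      have := hu.1.continuous
      have := hX.1.continuous
      simp only [Pi.add_apply, Pi.smul_apply]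
      fun_prop
    exact h.continuousAt.eventually_mem (hΩ.mem_nhds (by simpa using hu.2 x))
  filter_upwards [hmem] with s hs
  refine ⟨hu.1.add (hX.1.const_smul s), fun x => ?_⟩
  by_cases hx : x ∈ tsupport X
  · exact hs x hx
  · simpa [image_eq_zero_of_notMem_tsupport hx] using hu.2 x

theorem exists_isTestCovector_eventuallyEq (hX : ContDiff ℝ ∞ X) {K : Set ℝ} (hK : IsCompact K) :
    ∃ Y, IsTestCovector Y ∧ ∀ x ∈ K, Y =ᶠ[𝓝 x] X := by
  obtain ⟨R, hR, hKR⟩ := hK.isBounded.subset_ball_lt 0 0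
  let χ : ContDiffBump (0 : ℝ) := ⟨R, R + 1, hR, lt_add_one R⟩
  refine ⟨fun x => χ x • X x, ⟨χ.contDiff.smul hX, χ.hasCompactSupport.smul_right⟩, fun x hx => ?_⟩
  filter_upwards [Metric.isOpen_ball.mem_nhds (hKR hx)] with y hy
  rw [χ.one_of_mem_closedBall (Metric.ball_subset_closedBall hy), one_smul]

end TestCovectors

section GermDependence

variable {n : ℕ} {Ω : Set (Fin n → ℝ)} {J J₁ J₂ : FieldOperator n} {u v X a b : ℝ → Fin n → ℝ}

/-- The value of `J_u b` at `x` depends only on the germs of the field `u` at `x` and along the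
support of `b`. Outside these points `u` may then be modified, in particular it may be moved back
into the domain of `J`. -/
def IsGermDependent (J : FieldOperator n) : Prop :=
  ∀ u v b x, (∀ y ∈ insert x (tsupport b), u =ᶠ[𝓝 y] v) → J u b x = J v b x

theorem IsGermDependent.linear_combination (h₁ : IsGermDependent J₁) (h₂ : IsGermDependent J₂)
    (c₁ c₂ : ℝ) : IsGermDependent (c₁ • J₁ + c₂ • J₂) := by
  intro u v b x h
  change c₁ • J₁ u b x + c₂ • J₂ u b x = c₁ • J₁ v b x + c₂ • J₂ v b x
  rw [h₁ u v b x h, h₂ u v b x h]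

theorem IsGermDependent.linBracket_congr (hJ : IsGermDependent J)
    (h : ∀ x ∈ tsupport a ∪ tsupport b, u =ᶠ[𝓝 x] v) :
    linBracket J a b u = linBracket J a b v := by
  refine integral_congr_ae (Eventually.of_forall fun x => ?_)
  by_cases hx : x ∈ tsupport a
  · have hins : insert x (tsupport b) ⊆ tsupport a ∪ tsupport b :=
      Set.insert_subset (.inl hx) Set.subset_union_right
    simp only [hJ u v b x fun y hy => h y (hins hy)]
  · simp only [image_eq_zero_of_notMem_tsupport hx, zero_dotProduct]

theorem exists_isTestCovector_linBracket_add_smul_eq (ha : IsTestCovector a)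
    (hb : IsTestCovector b) (hX : ContDiff ℝ ∞ X) :
    ∃ Y, IsTestCovector Y ∧ (∀ x ∈ tsupport a ∪ tsupport b, Y x = X x) ∧
      ∀ J, IsGermDependent J → ∀ u, ∀ s : ℝ,
        linBracket J a b (u + s • X) = linBracket J a b (u + s • Y) := by
  obtain ⟨Y, hY, hXY⟩ := exists_isTestCovector_eventuallyEq hX (ha.2.isCompact.union hb.2.isCompact)
  refine ⟨Y, hY, fun x hx => (hXY x hx).eq_of_nhds, fun J hJ u s => hJ.linBracket_congr ?_⟩
  intro x hx
  filter_upwards [hXY x hx] with y hy using by simp [hy]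

theorem IsHamiltonianOperator.congr (hΩ : IsOpen Ω) (h₁ : IsGermDependent J₁)
    (h₂ : IsGermDependent J₂) (h : SameOperatorOn Ω J₁ J₂) (hJ : IsHamiltonianOperator Ω J₁) :
    IsHamiltonianOperator Ω J₂ := by
  have linBracket_eq {u a b} (hu : IsSmoothField Ω u) (hb : IsTestCovector b) :
      linBracket J₁ a b u = linBracket J₂ a b u := by
    simp only [linBracket, h u b hu hb]
  have derivative_eq {u a b c d} (hu : IsSmoothField Ω u) (ha : IsTestCovector a)
      (hb : IsTestCovector b) (hc : IsTestCovector c)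
      (hd : HasDerivAt (fun s : ℝ => linBracket J₁ a b (u + s • J₁ u c)) d 0) :
      HasDerivAt (fun s : ℝ => linBracket J₂ a b (u + s • J₂ u c)) d 0 := by
    obtain ⟨Y, hY, -, hXY⟩ := exists_isTestCovector_linBracket_add_smul_eq ha hb
      (hJ.smooth u c hu hc)
    rw [← h u c hu hc]
    refine hd.congr_of_eventuallyEq ?_
    filter_upwards [hu.eventually_add_smul hΩ hY] with s hs
    rw [hXY J₁ h₁, hXY J₂ h₂, linBracket_eq hs hb]
  refine ⟨fun u a hu ha => h u a hu ha ▸ hJ.smooth u a hu ha, fun u a b hu ha hb => ?_,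
    fun u a r hu ha => ?_, fun u a b hu ha hb => ?_, fun u a b c hu ha hb hc => ?_⟩
  · rw [← h u a hu ha, ← h u b hu hb, ← hJ.map_add u a b hu ha hb]
    exact (h u _ hu ⟨ha.1.add hb.1, ha.2.add hb.2⟩).symm
  · rw [← h u a hu ha, ← hJ.map_smul u a r hu ha]
    exact (h u _ hu ⟨ha.1.const_smul r, ha.2.smul_left (f := fun _ => r)⟩).symm
  · rw [← linBracket_eq hu hb, ← linBracket_eq hu ha, hJ.skew u a b hu ha hb]
  · obtain ⟨d₁, d₂, d₃, hd₁, hd₂, hd₃, hsum⟩ := hJ.jacobi u a b c hu ha hb hc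
    exact ⟨d₁, d₂, d₃, derivative_eq hu ha hb hc hd₁, derivative_eq hu hb hc ha hd₂,
      derivative_eq hu hc ha hb hd₃, hsum⟩

end GermDependence

namespace HydroOperator

variable {n m : ℕ} {Ω : Set (Fin n → ℝ)} {J : HydroOperator n m} {u a b : ℝ → Fin n → ℝ}

/-- The densities `(right(u, uₓ) a)ₖ` to which `(d/dx)⁻¹` is applied in `J_u a`. -/
noncomputable def tail (J : HydroOperator n m) (u a : ℝ → Fin n → ℝ) (k : Fin m) (x : ℝ) : ℝ :=
  (J.right (u x) (deriv u x) *ᵥ a x) k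

/-- The coefficients of `J` are smooth functions of `(u, uₓ)` as long as `u ∈ Ω`. -/
structure IsSmoothOn (J : HydroOperator n m) (Ω : Set (Fin n → ℝ)) : Prop where
  lead : ∀ p ∈ Ω, ∀ i j, ContDiffAt ℝ ∞ (fun q => J.lead q i j) p
  coef : ∀ p ∈ Ω, ∀ ξ i j,
    ContDiffAt ℝ ∞ (fun z : (Fin n → ℝ) × (Fin n → ℝ) => J.coef z.1 z.2 i j) (p, ξ)
  left : ∀ p ∈ Ω, ∀ ξ i k,
    ContDiffAt ℝ ∞ (fun z : (Fin n → ℝ) × (Fin n → ℝ) => J.left z.1 z.2 i k) (p, ξ)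
  right : ∀ p ∈ Ω, ∀ ξ k i,
    ContDiffAt ℝ ∞ (fun z : (Fin n → ℝ) × (Fin n → ℝ) => J.right z.1 z.2 k i) (p, ξ)

theorem toFieldOperator_apply (x : ℝ) :
    J.toFieldOperator u a x = J.lead (u x) *ᵥ deriv a x + J.coef (u x) (deriv u x) *ᵥ a x +
      J.left (u x) (deriv u x) *ᵥ fun k => invD (J.tail u a k) x :=
  rfl

theorem hasCompactSupport_tail (ha : IsTestCovector a) (k : Fin m) :
    HasCompactSupport (J.tail u a k) :=
  HasCompactSupport.intro ha.2 fun x hx => by simp [tail, image_eq_zero_of_notMem_tsupport hx]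

theorem contDiff_tail (hJ : J.IsSmoothOn Ω) (hu : IsSmoothField Ω u) (ha : IsTestCovector a)
    (k : Fin m) : ContDiff ℝ ∞ (J.tail u a k) := by
  refine contDiff_iff_contDiffAt.2 fun x => ?_
  obtain ⟨hu, huΩ⟩ := hu
  have hright (i : Fin n) : ContDiffAt ℝ ∞ (fun y => J.right (u y) (deriv u y) k i) x :=
    (hJ.right (u x) (huΩ x) (deriv u x) k i).comp x (f := fun y => (u y, deriv u y)) (by fun_prop)
  have := ha.1
  unfold tail Matrix.mulVec dotProduct
  fun_prop

theorem integrable_tail (hJ : J.IsSmoothOn Ω) (hu : IsSmoothField Ω u) (ha : IsTestCovector a)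
    (k : Fin m) : Integrable (J.tail u a k) :=
  (contDiff_tail hJ hu ha k).continuous.integrable_of_hasCompactSupport
    (hasCompactSupport_tail ha k)

theorem contDiff_toFieldOperator (hJ : J.IsSmoothOn Ω) (hu : IsSmoothField Ω u)
    (ha : IsTestCovector a) : ContDiff ℝ ∞ (J.toFieldOperator u a) := by
  refine contDiff_iff_contDiffAt.2 fun x => contDiffAt_pi.2 fun i => ?_
  have htail (k : Fin m) := contDiff_invD (contDiff_tail hJ hu ha k) (integrable_tail hJ hu ha k)
  obtain ⟨hu, huΩ⟩ := hu
  have hlead (j : Fin n) : ContDiffAt ℝ ∞ (fun y => J.lead (u y) i j) x :=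
    (hJ.lead (u x) (huΩ x) i j).comp x hu.contDiffAt
  have hcoef (j : Fin n) : ContDiffAt ℝ ∞ (fun y => J.coef (u y) (deriv u y) i j) x :=
    (hJ.coef (u x) (huΩ x) (deriv u x) i j).comp x (f := fun y => (u y, deriv u y)) (by fun_prop)
  have hleft (k : Fin m) : ContDiffAt ℝ ∞ (fun y => J.left (u y) (deriv u y) i k) x :=
    (hJ.left (u x) (huΩ x) (deriv u x) i k).comp x (f := fun y => (u y, deriv u y)) (by fun_prop)
  have := ha.1
  change ContDiffAt ℝ ∞ (fun y => (∑ j, J.lead (u y) i j * deriv a y j +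
    ∑ j, J.coef (u y) (deriv u y) i j * a y j) +
    ∑ k, J.left (u y) (deriv u y) i k * invD (J.tail u a k) y) x
  fun_prop

theorem toFieldOperator_add (hJ : J.IsSmoothOn Ω) (hu : IsSmoothField Ω u)
    (ha : IsTestCovector a) (hb : IsTestCovector b) :
    J.toFieldOperator u (a + b) = J.toFieldOperator u a + J.toFieldOperator u b := by
  have htail (k : Fin m) :
      invD (J.tail u (a + b) k) = invD (J.tail u a k) + invD (J.tail u b k) := by
    rw [← invD_add (integrable_tail hJ hu ha k) (integrable_tail hJ hu hb k)]
    congr 1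
    ext x
    simp [tail, Matrix.mulVec_add]
  have hderiv (x : ℝ) : deriv (a + b) x = deriv a x + deriv b x :=
    deriv_add (ha.1.differentiable (by simp) x) (hb.1.differentiable (by simp) x)
  ext x : 1
  have hsum : (fun k => invD (J.tail u (a + b) k) x) =
      (fun k => invD (J.tail u a k) x) + fun k => invD (J.tail u b k) x :=
    funext fun k => congrFun (htail k) x
  simp only [toFieldOperator_apply, Pi.add_apply, hsum, hderiv, Matrix.mulVec_add]
  abel

theorem toFieldOperator_smul (ha : IsTestCovector a) (r : ℝ) :
    J.toFieldOperator u (r • a) = r • J.toFieldOperator u a := by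
  have htail (k : Fin m) : invD (J.tail u (r • a) k) = r • invD (J.tail u a k) := by
    rw [← invD_smul]
    congr 1
    ext x
    simp [tail, Matrix.mulVec_smul]
  have hderiv (x : ℝ) : deriv (r • a) x = r • deriv a x :=
    deriv_const_smul r (ha.1.differentiable (by simp) x)
  ext x : 1
  have hprod : (fun k => invD (J.tail u (r • a) k) x) = r • fun k => invD (J.tail u a k) x :=
    funext fun k => congrFun (htail k) x
  simp only [toFieldOperator_apply, Pi.smul_apply, hprod, hderiv, Matrix.mulVec_smul, smul_add]

theorem isGermDependent (J : HydroOperator n m) : IsGermDependent J.toFieldOperator := by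
  intro u v b x h
  have htail (k : Fin m) : J.tail u b k = J.tail v b k := by
    ext y
    by_cases hy : y ∈ tsupport b
    · have huv := h y (Set.mem_insert_of_mem _ hy)
      rw [tail, tail, huv.deriv_eq, huv.eq_of_nhds]
    · simp [tail, image_eq_zero_of_notMem_tsupport hy]
  have huv := h x (Set.mem_insert _ _)
  simp only [toFieldOperator_apply, htail, huv.deriv_eq, huv.eq_of_nhds]

end HydroOperator

section ChaplyginOperator

variable {U V : Set ℝ} {f φ : ℝ → ℝ} {u a b : ℝ → Fin 2 → ℝ} {x : ℝ}

theorem isOpen_offDiagonal (hU : IsOpen U) (hV : IsOpen V) : IsOpen (offDiagonal U V) :=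
  (hU.preimage (continuous_apply 0)).inter <| (hV.preimage (continuous_apply 1)).inter <|
    isOpen_ne_fun (continuous_apply 0) (continuous_apply 1)

theorem hasDerivAt_coord {n : ℕ} {u : ℝ → Fin n → ℝ} (hu : ContDiff ℝ ∞ u) (i : Fin n) (x : ℝ) :
    HasDerivAt (fun y => u y i) (deriv u x i) x :=
  hasDerivAt_pi.1 (hu.differentiable (by simp) x).hasDerivAt i

theorem contDiffAt_deriv {t : ℝ} (hf : ContDiffAt ℝ ∞ f t) : ContDiffAt ℝ ∞ (deriv f) t :=
  (hf.fderiv_right (by simp)).clm_apply contDiffAt_const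

theorem hasDerivAt_of_contDiffAt {t : ℝ} (hf : ContDiffAt ℝ ∞ f t) : HasDerivAt f (deriv f t) t :=
  (hf.differentiableAt (by simp)).hasDerivAt

theorem contDiffAt_speed₁ {p : Fin 2 → ℝ} (hf : ContDiffAt ℝ ∞ f (p 0))
    (hφ : ContDiffAt ℝ ∞ φ (p 1)) : ContDiffAt ℝ ∞ (speed₁ f φ) p := by
  have := contDiffAt_deriv hf
  unfold speed₁
  fun_prop

theorem contDiffAt_speed₂ {p : Fin 2 → ℝ} (hf : ContDiffAt ℝ ∞ f (p 0))
    (hφ : ContDiffAt ℝ ∞ φ (p 1)) : ContDiffAt ℝ ∞ (speed₂ f φ) p := by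
  have := contDiffAt_deriv hφ
  unfold speed₂
  fun_prop

theorem contDiffAt_matrix_apply {E : Type*} [NormedAddCommGroup E] [NormedSpace ℝ E]
    {A B C D : E → ℝ} {p : E} (hA : ContDiffAt ℝ ∞ A p) (hB : ContDiffAt ℝ ∞ B p)
    (hC : ContDiffAt ℝ ∞ C p) (hD : ContDiffAt ℝ ∞ D p) (i j : Fin 2) :
    ContDiffAt ℝ ∞ (fun q => !![A q, B q; C q, D q] i j) p := by
  fin_cases i <;> fin_cases j <;> assumption

theorem isSmoothOn_chaplyginOperator (hf : ∀ t ∈ U, ContDiffAt ℝ ∞ f t)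
    (hφ : ∀ t ∈ V, ContDiffAt ℝ ∞ φ t) :
    (chaplyginOperator f φ).IsSmoothOn (offDiagonal U V) where
  lead p hp i j := by
    have := hf _ hp.1
    have := hφ _ hp.2.1
    exact ContDiffAt.mul (by fun_prop)
      (contDiffAt_matrix_apply (by fun_prop) (by fun_prop) (by fun_prop) (by fun_prop) i j)
  coef p hp ξ i j := by
    have hf := hf _ hp.1
    have hφ := hφ _ hp.2.1
    have := contDiffAt_deriv hf
    have := contDiffAt_deriv hφ
    exact ContDiffAt.mul (by fun_prop)
      (contDiffAt_matrix_apply (by fun_prop) (by fun_prop) (by fun_prop) (by fun_prop) i j)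
  left p hp ξ := by
    have := contDiffAt_speed₁ (hf _ hp.1) (hφ _ hp.2.1)
    have := contDiffAt_speed₂ (hf _ hp.1) (hφ _ hp.2.1)
    exact contDiffAt_matrix_apply (by fun_prop) (by fun_prop) (by fun_prop) (by fun_prop)
  right p hp ξ := by
    have := contDiffAt_speed₁ (hf _ hp.1) (hφ _ hp.2.1)
    have := contDiffAt_speed₂ (hf _ hp.1) (hφ _ hp.2.1)
    exact contDiffAt_matrix_apply (by fun_prop) (by fun_prop) (by fun_prop) (by fun_prop)

/-- The determinant of the covectors `p` and `q` in the plane. -/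
def wedge (p q : Fin 2 → ℝ) : ℝ :=
  p 0 * q 1 - p 1 * q 0

/-- The Wronskian `aᵢ bᵢ' - aᵢ' bᵢ` of the `i`-th components of two covector fields. -/
noncomputable def wronskian (a b : ℝ → Fin 2 → ℝ) (i : Fin 2) (x : ℝ) : ℝ :=
  a x i * deriv b x i - deriv a x i * b x i

/-- The expression `uₓ a₀ + vₓ a₁`, the first of the two to which `(d/dx)⁻¹` is applied in the
operator. -/
noncomputable def translationFlux (u a : ℝ → Fin 2 → ℝ) (x : ℝ) : ℝ :=
  deriv u x 0 * a x 0 + deriv u x 1 * a x 1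

/-- The expression `w¹ uₓ a₀ + w² vₓ a₁`, the second of the two to which `(d/dx)⁻¹` is applied in
the operator. -/
noncomputable def speedFlux (f φ : ℝ → ℝ) (u a : ℝ → Fin 2 → ℝ) (x : ℝ) : ℝ :=
  speed₁ f φ (u x) * deriv u x 0 * a x 0 + speed₂ f φ (u x) * deriv u x 1 * a x 1

theorem tail_chaplyginOperator_zero :
    (chaplyginOperator f φ).tail u a 0 = translationFlux u a := by
  ext x
  simp [HydroOperator.tail, chaplyginOperator, translationFlux, Matrix.mulVec, dotProduct]

theorem tail_chaplyginOperator_one :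
    (chaplyginOperator f φ).tail u a 1 = speedFlux f φ u a := by
  ext x
  simp [HydroOperator.tail, chaplyginOperator, speedFlux, Matrix.mulVec, dotProduct]

theorem chaplyginOperator_apply_zero :
    (chaplyginOperator f φ).toFieldOperator u a x 0 =
      (u x 0 - u x 1) ^ 2 * f (u x 0) * deriv a x 0 +
      (u x 0 - u x 1) * ((1 / 2 * (u x 0 - u x 1) * deriv f (u x 0) * deriv u x 0 +
        f (u x 0) * (deriv u x 0 - deriv u x 1)) * a x 0 +
        (φ (u x 1) * deriv u x 0 + f (u x 0) * deriv u x 1) * a x 1) +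
      (speed₁ f φ (u x) * deriv u x 0 * invD (translationFlux u a) x +
        deriv u x 0 * invD (speedFlux f φ u a) x) := by
  simp only [HydroOperator.toFieldOperator_apply, Pi.add_apply, Matrix.mulVec, dotProduct,
    Fin.sum_univ_two, tail_chaplyginOperator_zero, tail_chaplyginOperator_one]
  simp only [chaplyginOperator, Matrix.smul_of, Matrix.smul_cons, smul_eq_mul, mul_zero,
    Matrix.smul_empty, Matrix.of_apply, Matrix.cons_val', Matrix.cons_val_zero,
    Matrix.cons_val_fin_one, Matrix.cons_val_one, zero_mul, add_zero]
  ring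

theorem chaplyginOperator_apply_one :
    (chaplyginOperator f φ).toFieldOperator u a x 1 =
      (u x 0 - u x 1) ^ 2 * φ (u x 1) * deriv a x 1 +
      (u x 0 - u x 1) * (-(φ (u x 1) * deriv u x 0 + f (u x 0) * deriv u x 1) * a x 0 +
        (1 / 2 * (u x 0 - u x 1) * deriv φ (u x 1) * deriv u x 1 +
        φ (u x 1) * (deriv u x 0 - deriv u x 1)) * a x 1) +
      (speed₂ f φ (u x) * deriv u x 1 * invD (translationFlux u a) x +
        deriv u x 1 * invD (speedFlux f φ u a) x) := by
  simp only [HydroOperator.toFieldOperator_apply, Pi.add_apply, Matrix.mulVec, dotProduct,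
    Fin.sum_univ_two, tail_chaplyginOperator_zero, tail_chaplyginOperator_one]
  simp only [chaplyginOperator, Matrix.smul_of, Matrix.smul_cons, smul_eq_mul, mul_zero,
    Matrix.smul_empty, Matrix.of_apply, Matrix.cons_val', Matrix.cons_val_zero,
    Matrix.cons_val_fin_one, Matrix.cons_val_one, zero_mul, zero_add]
  ring

/-- The local part of the skew-symmetric density of the bracket. -/
noncomputable def localDensity (f φ : ℝ → ℝ) (u a b : ℝ → Fin 2 → ℝ) (x : ℝ) : ℝ :=
  (u x 0 - u x 1) ^ 2 / 2 * (f (u x 0) * wronskian a b 0 x + φ (u x 1) * wronskian a b 1 x) +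
    (u x 0 - u x 1) * (φ (u x 1) * deriv u x 0 + f (u x 0) * deriv u x 1) * wedge (a x) (b x)

/-- A density of the bracket of two linear functionals which is manifestly skew-symmetric. It
differs from `aᵢ J^{ij} bⱼ` by a total derivative. -/
noncomputable def bracketDensity (f φ : ℝ → ℝ) (u a b : ℝ → Fin 2 → ℝ) (x : ℝ) : ℝ :=
  localDensity f φ u a b x + (speedFlux f φ u a x * invD (translationFlux u b) x -
    invD (translationFlux u a) x * speedFlux f φ u b x)

theorem bracketDensity_swap : bracketDensity f φ u b a x = -bracketDensity f φ u a b x := by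
  simp only [bracketDensity, localDensity, wronskian, wedge]
  ring

/-- The variational derivative of the functional with density `localDensity f φ u a b`. -/
noncomputable def localGradient (f φ : ℝ → ℝ) (u a b : ℝ → Fin 2 → ℝ) (x : ℝ) : Fin 2 → ℝ :=
  let d := u x 0 - u x 1
  let f' := deriv f (u x 0)
  let φ' := deriv φ (u x 1)
  let η := wedge (a x) (b x)
  let η' := wedge (deriv a x) (b x) + wedge (a x) (deriv b x)
  let κ := f (u x 0) + φ (u x 1) + d * (f' - φ')
  ![(d * f (u x 0) + d ^ 2 / 2 * f') * wronskian a b 0 x + d * φ (u x 1) * wronskian a b 1 x +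
      κ * η * deriv u x 1 - d * φ (u x 1) * η',
    (d ^ 2 / 2 * φ' - d * φ (u x 1)) * wronskian a b 1 x - d * f (u x 0) * wronskian a b 0 x -
      κ * η * deriv u x 0 - d * f (u x 0) * η']

/-- The variational derivative of the bracket of the linear functionals with differentials `a` and
`b`. -/
noncomputable def bracketGradient (f φ : ℝ → ℝ) (u a b : ℝ → Fin 2 → ℝ) (x : ℝ) : Fin 2 → ℝ :=
  let f' := deriv f (u x 0)
  let φ' := deriv φ (u x 1)
  let T := invD (translationFlux u a) x
  let T' := invD (translationFlux u b) x
  let S := invD (speedFlux f φ u a) x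
  let S' := invD (speedFlux f φ u b) x
  let ν := (speed₁ f φ (u x) + speed₂ f φ (u x)) * wedge (a x) (b x) +
    (f' + φ') / 2 * ((a x 1 - a x 0) * T' - (b x 1 - b x 0) * T)
  localGradient f φ u a b x -
    ![ν * deriv u x 1 + speed₁ f φ (u x) * (deriv a x 0 * T' - deriv b x 0 * T) +
        (deriv a x 0 * S' - deriv b x 0 * S),
      -ν * deriv u x 0 + speed₂ f φ (u x) * (deriv a x 1 * T' - deriv b x 1 * T) +
        (deriv a x 1 * S' - deriv b x 1 * S)]

theorem bracketGradient_jacobi :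
    bracketGradient f φ u a b x ⬝ᵥ (chaplyginOperator f φ).toFieldOperator u c x +
      bracketGradient f φ u b c x ⬝ᵥ (chaplyginOperator f φ).toFieldOperator u a x +
      bracketGradient f φ u c a x ⬝ᵥ (chaplyginOperator f φ).toFieldOperator u b x = 0 := by
  simp only [dotProduct, Fin.sum_univ_two, chaplyginOperator_apply_zero,
    chaplyginOperator_apply_one, bracketGradient, localGradient, Pi.sub_apply,
    Matrix.cons_val_zero, Matrix.cons_val_one, wronskian, wedge, speed₁, speed₂]
  generalize invD (translationFlux u a) x = Ta, invD (translationFlux u b) x = Tb,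
    invD (translationFlux u c) x = Tc, invD (speedFlux f φ u a) x = Sa,
    invD (speedFlux f φ u b) x = Sb, invD (speedFlux f φ u c) x = Sc
  generalize u x 0 = p, u x 1 = q, deriv u x 0 = ux, deriv u x 1 = vx
  generalize f p = F, φ q = Φ, deriv f p = F', deriv φ q = Φ'
  ring

end ChaplyginOperator

section Variation

variable {U V : Set ℝ} {f φ : ℝ → ℝ} {u X a b : ℝ → Fin 2 → ℝ} {x : ℝ}

theorem integral_add_of_integral_eq_zero {G h : ℝ → ℝ} (hh : Integrable h) (h₀ : ∫ x, h x = 0) :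
    ∫ x, (G x + h x) = ∫ x, G x := by
  by_cases hG : Integrable G
  · rw [integral_add hG hh, h₀, add_zero]
  · rw [integral_undef hG, integral_undef fun hs => hG ?_]
    exact (hs.sub hh).congr (Eventually.of_forall fun x => add_sub_cancel_right (G x) (h x))

theorem integral_add_deriv (G : ℝ → ℝ) {Q : ℝ → ℝ} (hQ : ContDiff ℝ ∞ Q)
    (hQc : HasCompactSupport Q) : ∫ x, (G x + deriv Q x) = ∫ x, G x := by
  have hQ' : Integrable (deriv Q) :=
    (hQ.continuous_deriv (by simp)).integrable_of_hasCompactSupport hQc.deriv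
  exact integral_add_of_integral_eq_zero hQ' <| integral_eq_zero_of_hasDerivAt_of_integrable
    (fun x => (hQ.differentiable (by simp) x).hasDerivAt) hQ'
    (hQ.continuous.integrable_of_hasCompactSupport hQc)

theorem integral_add_mul_invD_add_invD_mul (G : ℝ → ℝ) {p q : ℝ → ℝ} (hp : Continuous p)
    (hpc : HasCompactSupport p) (hq : Continuous q) (hqc : HasCompactSupport q) :
    ∫ x, (G x + (p x * invD q x + invD p x * q x)) = ∫ x, G x := by
  have hpi : Integrable p := hp.integrable_of_hasCompactSupport hpc
  have hqi : Integrable q := hq.integrable_of_hasCompactSupport hqc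
  have continuous_invD {r : ℝ → ℝ} (hr : Continuous r) (hri : Integrable r) :
      Continuous (invD r) :=
    continuous_iff_continuousAt.2 fun x => (hasDerivAt_invD hr hri x).continuousAt
  have hi : Integrable fun x => p x * invD q x + invD p x * q x :=
    Integrable.add
      ((hp.mul (continuous_invD hq hqi)).integrable_of_hasCompactSupport hpc.mul_right)
      (((continuous_invD hp hpi).mul hq).integrable_of_hasCompactSupport hqc.mul_left)
  exact integral_add_of_integral_eq_zero hi (integral_mul_invD_add_invD_mul hp hpi hq hqi hi)

theorem contDiff_translationFlux (hu : ContDiff ℝ ∞ u) (ha : ContDiff ℝ ∞ a) :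
    ContDiff ℝ ∞ (translationFlux u a) := by
  unfold translationFlux
  fun_prop

theorem hasCompactSupport_translationFlux (ha : HasCompactSupport a) :
    HasCompactSupport (translationFlux u a) :=
  HasCompactSupport.intro ha fun x hx => by
    simp [translationFlux, image_eq_zero_of_notMem_tsupport hx]

theorem contDiff_speedFlux (hf : ∀ t ∈ U, ContDiffAt ℝ ∞ f t) (hφ : ∀ t ∈ V, ContDiffAt ℝ ∞ φ t)
    (hu : IsSmoothField (offDiagonal U V) u) (ha : IsTestCovector a) :
    ContDiff ℝ ∞ (speedFlux f φ u a) :=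
  tail_chaplyginOperator_one ▸
    HydroOperator.contDiff_tail (isSmoothOn_chaplyginOperator hf hφ) hu ha 1

theorem hasCompactSupport_speedFlux (ha : IsTestCovector a) :
    HasCompactSupport (speedFlux f φ u a) :=
  tail_chaplyginOperator_one ▸ HydroOperator.hasCompactSupport_tail ha 1

theorem hasDerivAt_invD_translationFlux (hu : ContDiff ℝ ∞ u) (ha : IsTestCovector a) (x : ℝ) :
    HasDerivAt (invD (translationFlux u a)) (translationFlux u a x) x :=
  have ht := (contDiff_translationFlux hu ha.1).continuous
  hasDerivAt_invD ht (ht.integrable_of_hasCompactSupport (hasCompactSupport_translationFlux ha.2)) x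

theorem hasDerivAt_invD_speedFlux (hf : ∀ t ∈ U, ContDiffAt ℝ ∞ f t)
    (hφ : ∀ t ∈ V, ContDiffAt ℝ ∞ φ t) (hu : IsSmoothField (offDiagonal U V) u)
    (ha : IsTestCovector a) (x : ℝ) :
    HasDerivAt (invD (speedFlux f φ u a)) (speedFlux f φ u a x) x :=
  have hs := (contDiff_speedFlux hf hφ hu ha).continuous
  hasDerivAt_invD hs (hs.integrable_of_hasCompactSupport (hasCompactSupport_speedFlux ha)) x

theorem linBracket_eq_integral_bracketDensity (hf : ∀ t ∈ U, ContDiffAt ℝ ∞ f t)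
    (hφ : ∀ t ∈ V, ContDiffAt ℝ ∞ φ t) (hu : IsSmoothField (offDiagonal U V) u)
    (ha : IsTestCovector a) (hb : IsTestCovector b) :
    linBracket (chaplyginOperator f φ).toFieldOperator a b u =
      ∫ x, bracketDensity f φ u a b x := by
  set Q : ℝ → ℝ := fun x => (u x 0 - u x 1) ^ 2 / 2 *
    (f (u x 0) * a x 0 * b x 0 + φ (u x 1) * a x 1 * b x 1)
  have hQ : ContDiff ℝ ∞ Q := contDiff_iff_contDiffAt.2 fun x => by
    have := hf _ (hu.2 x).1
    have := hφ _ (hu.2 x).2.1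
    have := hu.1
    have := ha.1
    have := hb.1
    fun_prop
  have hQc : HasCompactSupport Q := HasCompactSupport.intro ha.2 fun x hx => by
    simp [Q, image_eq_zero_of_notMem_tsupport hx]
  rw [← integral_add_deriv _ hQ hQc, ← integral_add_mul_invD_add_invD_mul _
    (contDiff_translationFlux hu.1 ha.1).continuous (hasCompactSupport_translationFlux ha.2)
    (contDiff_speedFlux hf hφ hu hb).continuous (hasCompactSupport_speedFlux hb)]
  refine integral_congr_ae (Eventually.of_forall fun x => ?_)
  have hu0 := hasDerivAt_coord hu.1 0 x
  have hu1 := hasDerivAt_coord hu.1 1 x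
  have hfu := (hasDerivAt_of_contDiffAt (hf _ (hu.2 x).1)).comp x hu0
  have hφu := (hasDerivAt_of_contDiffAt (hφ _ (hu.2 x).2.1)).comp x hu1
  have hQ' : deriv Q x = _ := ((((hu0.sub hu1).pow 2).div_const 2).mul
    (((hfu.mul (hasDerivAt_coord ha.1 0 x)).mul (hasDerivAt_coord hb.1 0 x)).add
      ((hφu.mul (hasDerivAt_coord ha.1 1 x)).mul (hasDerivAt_coord hb.1 1 x)))).deriv
  simp only [dotProduct, Fin.sum_univ_two, chaplyginOperator_apply_zero,
    chaplyginOperator_apply_one, bracketDensity, localDensity, wronskian, wedge, hQ',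
    translationFlux, speedFlux, Function.comp_apply, Pi.mul_apply, Pi.sub_apply, Pi.add_apply,
    Pi.pow_apply]
  push_cast
  ring

theorem hasDerivAt_speed₁_comp {γ : ℝ → Fin 2 → ℝ} {γ' : Fin 2 → ℝ} {t : ℝ}
    (hf : ContDiffAt ℝ ∞ f (γ t 0)) (hφ : ContDiffAt ℝ ∞ φ (γ t 1)) (hγ : HasDerivAt γ γ' t) :
    HasDerivAt (fun t => speed₁ f φ (γ t))
      (((γ t 0 - γ t 1) * deriv (deriv f) (γ t 0) * γ' 0 -
        (deriv f (γ t 0) + deriv φ (γ t 1)) * γ' 1) / 2) t := by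
  have h0 := hasDerivAt_pi.1 hγ 0
  have h1 := hasDerivAt_pi.1 hγ 1
  refine HasDerivAt.congr_deriv (((((h0.sub h1).mul
    ((hasDerivAt_of_contDiffAt (contDiffAt_deriv hf)).comp t h0)).sub
      ((hasDerivAt_of_contDiffAt hf).comp t h0)).sub
        ((hasDerivAt_of_contDiffAt hφ).comp t h1)).const_mul (1 / 2)) ?_
  simp only [Function.comp_apply, Pi.sub_apply]
  ring

theorem hasDerivAt_speed₂_comp {γ : ℝ → Fin 2 → ℝ} {γ' : Fin 2 → ℝ} {t : ℝ}
    (hf : ContDiffAt ℝ ∞ f (γ t 0)) (hφ : ContDiffAt ℝ ∞ φ (γ t 1)) (hγ : HasDerivAt γ γ' t) :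
    HasDerivAt (fun t => speed₂ f φ (γ t))
      (((γ t 1 - γ t 0) * deriv (deriv φ) (γ t 1) * γ' 1 -
        (deriv f (γ t 0) + deriv φ (γ t 1)) * γ' 0) / 2) t := by
  have h0 := hasDerivAt_pi.1 hγ 0
  have h1 := hasDerivAt_pi.1 hγ 1
  refine HasDerivAt.congr_deriv (((((h1.sub h0).mul
    ((hasDerivAt_of_contDiffAt (contDiffAt_deriv hφ)).comp t h1)).sub
      ((hasDerivAt_of_contDiffAt hf).comp t h0)).sub
        ((hasDerivAt_of_contDiffAt hφ).comp t h1)).const_mul (1 / 2)) ?_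
  simp only [Function.comp_apply, Pi.sub_apply]
  ring

theorem hasDerivAt_add_smul (u X : ℝ → Fin 2 → ℝ) (x : ℝ) :
    HasDerivAt (fun s : ℝ => (u + s • X) x) (X x) 0 := by
  simpa using ((hasDerivAt_id (0 : ℝ)).smul_const (X x)).const_add (u x)

theorem hasDerivAt_deriv_add_smul (hu : ContDiff ℝ ∞ u) (hX : ContDiff ℝ ∞ X) (x : ℝ) :
    HasDerivAt (fun s : ℝ => deriv (u + s • X) x) (deriv X x) 0 := by
  simpa only [deriv_add_smul hu hX, id, one_smul] using
    ((hasDerivAt_id (0 : ℝ)).smul_const (deriv X x)).const_add (deriv u x)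

/-- The contraction of the covector `a` with the vector obtained from `X` by applying the matrix of
the speeds `w¹`, `w²`. -/
noncomputable def speedContraction (f φ : ℝ → ℝ) (u X a : ℝ → Fin 2 → ℝ) (x : ℝ) : ℝ :=
  speed₁ f φ (u x) * X x 0 * a x 0 + speed₂ f φ (u x) * X x 1 * a x 1

theorem hasDerivAt_speedContraction (hf : ContDiffAt ℝ ∞ f (u x 0))
    (hφ : ContDiffAt ℝ ∞ φ (u x 1)) (hu : ContDiff ℝ ∞ u) (hX : ContDiff ℝ ∞ X)
    (ha : ContDiff ℝ ∞ a) :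
    HasDerivAt (speedContraction f φ u X a)
      (((u x 0 - u x 1) * deriv (deriv f) (u x 0) * deriv u x 0 -
          (deriv f (u x 0) + deriv φ (u x 1)) * deriv u x 1) / 2 * (X x 0 * a x 0) +
        ((u x 1 - u x 0) * deriv (deriv φ) (u x 1) * deriv u x 1 -
          (deriv f (u x 0) + deriv φ (u x 1)) * deriv u x 0) / 2 * (X x 1 * a x 1) +
        speed₁ f φ (u x) * (deriv X x 0 * a x 0 + X x 0 * deriv a x 0) +
        speed₂ f φ (u x) * (deriv X x 1 * a x 1 + X x 1 * deriv a x 1)) x := by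
  have hux := (hu.differentiable (by simp) x).hasDerivAt
  refine HasDerivAt.congr_deriv
    ((((hasDerivAt_speed₁_comp hf hφ hux).mul (hasDerivAt_coord hX 0 x)).mul
      (hasDerivAt_coord ha 0 x)).add
    (((hasDerivAt_speed₂_comp hf hφ hux).mul (hasDerivAt_coord hX 1 x)).mul
      (hasDerivAt_coord ha 1 x))) ?_
  simp only [Pi.mul_apply]
  ring

theorem hasDerivAt_speedFlux_add_smul (hf : ContDiffAt ℝ ∞ f (u x 0))
    (hφ : ContDiffAt ℝ ∞ φ (u x 1)) (hu : ContDiff ℝ ∞ u) (hX : ContDiff ℝ ∞ X)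
    (ha : ContDiff ℝ ∞ a) :
    HasDerivAt (fun s : ℝ => speedFlux f φ (u + s • X) a x)
      (deriv (speedContraction f φ u X a) x - speedContraction f φ u X (deriv a) x +
        (deriv f (u x 0) + deriv φ (u x 1)) / 2 * (a x 1 - a x 0) *
          (X x 1 * deriv u x 0 - X x 0 * deriv u x 1)) 0 := by
  set γ : ℝ → Fin 2 → ℝ := fun s => (u + s • X) x with hγ
  have hs : HasDerivAt γ (X x) 0 := hasDerivAt_add_smul u X x
  have hs' := hasDerivAt_pi.1 (hasDerivAt_deriv_add_smul hu hX x)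
  have hu₀ : γ 0 = u x := by simp [hγ]
  rw [← hu₀] at hf hφ
  refine HasDerivAt.congr_deriv
    ((((hasDerivAt_speed₁_comp (γ := γ) hf hφ hs).mul (hs' 0)).mul_const (a x 0)).add
    (((hasDerivAt_speed₂_comp (γ := γ) hf hφ hs).mul (hs' 1)).mul_const (a x 1))) ?_
  rw [hu₀] at hf hφ ⊢
  simp only [(hasDerivAt_speedContraction hf hφ hu hX ha).deriv, speedContraction, zero_smul,
    add_zero]
  ring

end Variation

section BracketVariation

variable {U V : Set ℝ} {f φ : ℝ → ℝ} {u X a b : ℝ → Fin 2 → ℝ} {x : ℝ}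

/-- The function whose derivative is the difference between the variation of
`localDensity f φ u a b` in the direction `X` and the pairing of `localGradient f φ u a b`
with `X`. -/
noncomputable def localBoundaryTerm (f φ : ℝ → ℝ) (u X a b : ℝ → Fin 2 → ℝ) (x : ℝ) : ℝ :=
  (u x 0 - u x 1) * (φ (u x 1) * X x 0 + f (u x 0) * X x 1) * wedge (a x) (b x)

theorem hasDerivAt_wedge (ha : ContDiff ℝ ∞ a) (hb : ContDiff ℝ ∞ b) (x : ℝ) :
    HasDerivAt (fun y => wedge (a y) (b y))
      (wedge (deriv a x) (b x) + wedge (a x) (deriv b x)) x := by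
  refine HasDerivAt.congr_deriv (((hasDerivAt_coord ha 0 x).mul (hasDerivAt_coord hb 1 x)).sub
    ((hasDerivAt_coord ha 1 x).mul (hasDerivAt_coord hb 0 x))) ?_
  simp only [wedge]
  ring

theorem hasDerivAt_localBoundaryTerm (hf : ContDiffAt ℝ ∞ f (u x 0))
    (hφ : ContDiffAt ℝ ∞ φ (u x 1)) (hu : ContDiff ℝ ∞ u) (hX : ContDiff ℝ ∞ X)
    (ha : ContDiff ℝ ∞ a) (hb : ContDiff ℝ ∞ b) :
    HasDerivAt (localBoundaryTerm f φ u X a b)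
      (((deriv u x 0 - deriv u x 1) * (φ (u x 1) * X x 0 + f (u x 0) * X x 1) +
          (u x 0 - u x 1) * (deriv φ (u x 1) * deriv u x 1 * X x 0 + φ (u x 1) * deriv X x 0 +
            deriv f (u x 0) * deriv u x 0 * X x 1 + f (u x 0) * deriv X x 1)) *
          wedge (a x) (b x) +
        (u x 0 - u x 1) * (φ (u x 1) * X x 0 + f (u x 0) * X x 1) *
          (wedge (deriv a x) (b x) + wedge (a x) (deriv b x))) x := by
  have hu0 := hasDerivAt_coord hu 0 x
  have hu1 := hasDerivAt_coord hu 1 x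
  have hfu := (hasDerivAt_of_contDiffAt hf).comp x hu0
  have hφu := (hasDerivAt_of_contDiffAt hφ).comp x hu1
  refine HasDerivAt.congr_deriv (((hu0.sub hu1).mul ((hφu.mul (hasDerivAt_coord hX 0 x)).add
    (hfu.mul (hasDerivAt_coord hX 1 x)))).mul (hasDerivAt_wedge ha hb x)) ?_
  simp only [Function.comp_apply, Pi.sub_apply, Pi.mul_apply, Pi.add_apply]
  ring

theorem hasDerivAt_localDensity_add_smul (hf : ContDiffAt ℝ ∞ f (u x 0))
    (hφ : ContDiffAt ℝ ∞ φ (u x 1)) (hu : ContDiff ℝ ∞ u) (hX : ContDiff ℝ ∞ X)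
    (ha : ContDiff ℝ ∞ a) (hb : ContDiff ℝ ∞ b) :
    HasDerivAt (fun s : ℝ => localDensity f φ (u + s • X) a b x)
      (localGradient f φ u a b x ⬝ᵥ X x + deriv (localBoundaryTerm f φ u X a b) x) 0 := by
  have hs := hasDerivAt_pi.1 (hasDerivAt_add_smul u X x)
  have hs' := hasDerivAt_pi.1 (hasDerivAt_deriv_add_smul hu hX x)
  have hu₀ (i : Fin 2) : (u + (0 : ℝ) • X) x i = u x i := by simp
  rw [← hu₀ 0] at hf
  rw [← hu₀ 1] at hφ
  have hfs := (hasDerivAt_of_contDiffAt hf).comp (0 : ℝ) (hs 0)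
  have hφs := (hasDerivAt_of_contDiffAt hφ).comp (0 : ℝ) (hs 1)
  refine HasDerivAt.congr_deriv ((((((hs 0).sub (hs 1)).pow 2).div_const 2).mul
    ((hfs.mul_const (wronskian a b 0 x)).add (hφs.mul_const (wronskian a b 1 x)))).add
      ((((hs 0).sub (hs 1)).mul ((hφs.mul (hs' 0)).add (hfs.mul (hs' 1)))).mul_const
        (wedge (a x) (b x)))) ?_
  rw [hu₀] at hf hφ
  simp only [(hasDerivAt_localBoundaryTerm hf hφ hu hX ha hb).deriv, localGradient, dotProduct,
    Fin.sum_univ_two, Matrix.cons_val_zero, Matrix.cons_val_one, Function.comp_apply,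
    Pi.sub_apply, Pi.mul_apply, Pi.add_apply, Pi.pow_apply, Pi.zero_apply, zero_smul,
    add_zero]
  push_cast
  ring

theorem translationFlux_add_smul (hu : ContDiff ℝ ∞ u) (hX : ContDiff ℝ ∞ X) (s : ℝ) :
    translationFlux (u + s • X) a = translationFlux u a + s • translationFlux X a := by
  ext x
  simp only [translationFlux, deriv_add_smul hu hX, Pi.add_apply, Pi.smul_apply, smul_eq_mul]
  ring

theorem invD_translationFlux_add_smul (hu : ContDiff ℝ ∞ u) (hX : ContDiff ℝ ∞ X)
    (ha : IsTestCovector a) (s : ℝ) :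
    invD (translationFlux (u + s • X) a) =
      invD (translationFlux u a) + s • invD (translationFlux X a) := by
  have hi {w : ℝ → Fin 2 → ℝ} (hw : ContDiff ℝ ∞ w) : Integrable (translationFlux w a) :=
    (contDiff_translationFlux hw ha.1).continuous.integrable_of_hasCompactSupport
      (hasCompactSupport_translationFlux ha.2)
  rw [translationFlux_add_smul hu hX, invD_add (hi hu) ((hi hX).smul s), invD_smul]

theorem hasDerivAt_invD_translationFlux_add_smul (hu : ContDiff ℝ ∞ u) (hX : ContDiff ℝ ∞ X)
    (ha : IsTestCovector a) (x : ℝ) :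
    HasDerivAt (fun s : ℝ => invD (translationFlux (u + s • X) a) x)
      (invD (translationFlux X a) x) 0 := by
  simp only [invD_translationFlux_add_smul hu hX ha]
  simpa using ((hasDerivAt_id (0 : ℝ)).smul_const (invD (translationFlux X a) x)).const_add
    (invD (translationFlux u a) x)

/-- The analogue of `localBoundaryTerm` for `bracketDensity` and `bracketGradient`; the terms with
the perturbed nonlocal expressions remain in `hasDerivAt_bracketDensity_add_smul`. -/
noncomputable def boundaryTerm (f φ : ℝ → ℝ) (u X a b : ℝ → Fin 2 → ℝ) (x : ℝ) : ℝ :=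
  localBoundaryTerm f φ u X a b x +
    (speedContraction f φ u X a x * invD (translationFlux u b) x -
      invD (translationFlux u a) x * speedContraction f φ u X b x) +
    (X x ⬝ᵥ a x * invD (speedFlux f φ u b) x - invD (speedFlux f φ u a) x * (X x ⬝ᵥ b x))

theorem hasDerivAt_bracketDensity_add_smul (hf : ∀ t ∈ U, ContDiffAt ℝ ∞ f t)
    (hφ : ∀ t ∈ V, ContDiffAt ℝ ∞ φ t) (hu : IsSmoothField (offDiagonal U V) u)
    (hX : ContDiff ℝ ∞ X) (ha : IsTestCovector a) (hb : IsTestCovector b) :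
    HasDerivAt (fun s : ℝ => bracketDensity f φ (u + s • X) a b x)
      (bracketGradient f φ u a b x ⬝ᵥ X x + deriv (boundaryTerm f φ u X a b) x +
        (speedFlux f φ u a x * invD (translationFlux X b) x +
          invD (speedFlux f φ u a) x * translationFlux X b x) -
        (translationFlux X a x * invD (speedFlux f φ u b) x +
          invD (translationFlux X a) x * speedFlux f φ u b x)) 0 := by
  have hfx := hf _ (hu.2 x).1
  have hφx := hφ _ (hu.2 x).2.1
  have hS {w} (hw : IsTestCovector w) := hasDerivAt_speedFlux_add_smul hfx hφx hu.1 hX hw.1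
  have hT {w} (hw : IsTestCovector w) := hasDerivAt_invD_translationFlux_add_smul hu.1 hX hw x
  have hC {w} (hw : IsTestCovector w) :=
    (hasDerivAt_speedContraction hfx hφx hu.1 hX hw.1).differentiableAt.hasDerivAt
  have hP {w : ℝ → Fin 2 → ℝ} (hw : IsTestCovector w) :
      HasDerivAt (fun y => X y ⬝ᵥ w y) (deriv X x ⬝ᵥ w x + X x ⬝ᵥ deriv w x) x := by
    refine HasDerivAt.congr_deriv (HasDerivAt.fun_sum fun i _ =>
      (hasDerivAt_coord hX i x).mul (hasDerivAt_coord hw.1 i x)) ?_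
    simp only [dotProduct, Finset.sum_add_distrib]
  have hB : deriv (boundaryTerm f φ u X a b) x = _ :=
    (((hasDerivAt_localBoundaryTerm hfx hφx hu.1 hX ha.1 hb.1).differentiableAt.hasDerivAt.add
      (((hC ha).mul (hasDerivAt_invD_translationFlux hu.1 hb x)).sub
        ((hasDerivAt_invD_translationFlux hu.1 ha x).mul (hC hb)))).add
      (((hP ha).mul (hasDerivAt_invD_speedFlux hf hφ hu hb x)).sub
        ((hasDerivAt_invD_speedFlux hf hφ hu ha x).mul (hP hb)))).deriv
  refine HasDerivAt.congr_deriv ((hasDerivAt_localDensity_add_smul hfx hφx hu.1 hX ha.1 hb.1).add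
    (((hS ha).mul (hT hb)).sub ((hT ha).mul (hS hb)))) ?_
  simp only [hB, bracketGradient, translationFlux, speedFlux, speedContraction, wedge,
    sub_dotProduct, zero_smul, add_zero]
  simp only [dotProduct, Fin.sum_univ_two, Matrix.cons_val_zero, Matrix.cons_val_one]
  ring

end BracketVariation

section Jacobi

variable {U V : Set ℝ} {f φ : ℝ → ℝ} {u X a b : ℝ → Fin 2 → ℝ}

theorem contDiffAt_bracketDensity_add_smul (hf : ∀ t ∈ U, ContDiffAt ℝ ∞ f t)
    (hφ : ∀ t ∈ V, ContDiffAt ℝ ∞ φ t) (hu : IsSmoothField (offDiagonal U V) u)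
    (hX : ContDiff ℝ ∞ X) (ha : IsTestCovector a) (hb : IsTestCovector b) (x : ℝ) :
    ContDiffAt ℝ ∞ (fun z : ℝ × ℝ => bracketDensity f φ (u + z.1 • X) a b z.2) (0, x) := by
  have hfx := hf _ (hu.2 x).1
  have hφx := hφ _ (hu.2 x).2.1
  obtain ⟨hu, -⟩ := hu
  have hT {v w : ℝ → Fin 2 → ℝ} (hv : ContDiff ℝ ∞ v) (hw : IsTestCovector w) :
      ContDiff ℝ ∞ (invD (translationFlux v w)) :=
    have ht := contDiff_translationFlux hv hw.1
    contDiff_invD ht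
      (ht.continuous.integrable_of_hasCompactSupport (hasCompactSupport_translationFlux hw.2))
  have := hT hu ha
  have := hT hu hb
  have := hT hX ha
  have := hT hX hb
  have hfs : ContDiffAt ℝ ∞ f (u x 0 + 0 * X x 0) := by simpa using hfx
  have hφs : ContDiffAt ℝ ∞ φ (u x 1 + 0 * X x 1) := by simpa using hφx
  have := contDiffAt_deriv hfs
  have := contDiffAt_deriv hφs
  have := ha.1
  have := hb.1
  simp only [bracketDensity, localDensity, speedFlux, speed₁, speed₂, wedge,
    wronskian, deriv_add_smul hu hX, invD_translationFlux_add_smul hu hX ha,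
    invD_translationFlux_add_smul hu hX hb, Pi.add_apply, Pi.smul_apply, smul_eq_mul]
  fun_prop

theorem bracketDensity_eq_zero_of_notMem {x : ℝ} (hx : x ∉ tsupport a ∪ tsupport b) :
    bracketDensity f φ u a b x = 0 := by
  have ha : a x = 0 := image_eq_zero_of_notMem_tsupport fun h => hx (.inl h)
  have hb : b x = 0 := image_eq_zero_of_notMem_tsupport fun h => hx (.inr h)
  simp [bracketDensity, localDensity, speedFlux, wronskian, wedge, ha, hb]

theorem bracketGradient_eq_zero_of_notMem {x : ℝ} (hx : x ∉ tsupport a ∪ tsupport b) :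
    bracketGradient f φ u a b x = 0 := by
  have hxa : x ∉ tsupport a := fun h => hx (.inl h)
  have hxb : x ∉ tsupport b := fun h => hx (.inr h)
  ext i
  fin_cases i <;>
  simp [bracketGradient, localGradient, wronskian, wedge, image_eq_zero_of_notMem_tsupport hxa,
    image_eq_zero_of_notMem_tsupport hxb, deriv_eq_zero_of_notMem_tsupport hxa,
    deriv_eq_zero_of_notMem_tsupport hxb]

theorem contDiff_boundaryTerm (hf : ∀ t ∈ U, ContDiffAt ℝ ∞ f t)
    (hφ : ∀ t ∈ V, ContDiffAt ℝ ∞ φ t) (hu : IsSmoothField (offDiagonal U V) u)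
    (hX : ContDiff ℝ ∞ X) (ha : IsTestCovector a) (hb : IsTestCovector b) :
    ContDiff ℝ ∞ (boundaryTerm f φ u X a b) := by
  refine contDiff_iff_contDiffAt.2 fun x => ?_
  have hfx := hf _ (hu.2 x).1
  have hφx := hφ _ (hu.2 x).2.1
  have := contDiffAt_deriv hfx
  have := contDiffAt_deriv hφx
  have hT {w : ℝ → Fin 2 → ℝ} (hw : IsTestCovector w) :
      ContDiff ℝ ∞ (invD (translationFlux u w)) :=
    have ht := contDiff_translationFlux hu.1 hw.1
    contDiff_invD ht
      (ht.continuous.integrable_of_hasCompactSupport (hasCompactSupport_translationFlux hw.2))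
  have hS {w : ℝ → Fin 2 → ℝ} (hw : IsTestCovector w) :
      ContDiff ℝ ∞ (invD (speedFlux f φ u w)) :=
    have hs := contDiff_speedFlux hf hφ hu hw
    contDiff_invD hs
      (hs.continuous.integrable_of_hasCompactSupport (hasCompactSupport_speedFlux hw))
  have := hT ha
  have := hT hb
  have := hS ha
  have := hS hb
  have := hu.1
  have := ha.1
  have := hb.1
  unfold boundaryTerm localBoundaryTerm speedContraction speed₁ speed₂ wedge dotProduct
  fun_prop

theorem hasCompactSupport_boundaryTerm (ha : IsTestCovector a) (hb : IsTestCovector b) :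
    HasCompactSupport (boundaryTerm f φ u X a b) :=
  HasCompactSupport.intro (ha.2.isCompact.union hb.2.isCompact) fun x hx => by
    have ha : a x = 0 := image_eq_zero_of_notMem_tsupport fun h => hx (.inl h)
    have hb : b x = 0 := image_eq_zero_of_notMem_tsupport fun h => hx (.inr h)
    simp [boundaryTerm, localBoundaryTerm, speedContraction, wedge, ha, hb]

theorem hasDerivAt_linBracket_of_isTestCovector (hU : IsOpen U) (hV : IsOpen V)
    (hf : ∀ t ∈ U, ContDiffAt ℝ ∞ f t) (hφ : ∀ t ∈ V, ContDiffAt ℝ ∞ φ t)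
    (hu : IsSmoothField (offDiagonal U V) u) (hX : IsTestCovector X) (ha : IsTestCovector a)
    (hb : IsTestCovector b) :
    HasDerivAt (fun s : ℝ => linBracket (chaplyginOperator f φ).toFieldOperator a b (u + s • X))
      (∫ x, bracketGradient f φ u a b x ⬝ᵥ X x) 0 := by
  have hd := hasDerivAt_integral_of_contDiffAt
    (G := fun s x => bracketDensity f φ (u + s • X) a b x)
    (ha.2.isCompact.union hb.2.isCompact) (fun s x hx => bracketDensity_eq_zero_of_notMem hx)
    (fun x _ => (contDiffAt_bracketDensity_add_smul hf hφ hu hX.1 ha hb x).of_le (by simp))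
    (fun x => hasDerivAt_bracketDensity_add_smul hf hφ hu hX.1 ha hb)
  have hs {w} (hw : IsTestCovector w) := (contDiff_speedFlux hf hφ hu hw).continuous
  have ht {w} (hw : IsTestCovector w) := (contDiff_translationFlux hX.1 hw.1).continuous
  have hsc {w} (hw : IsTestCovector w) := hasCompactSupport_speedFlux (f := f) (φ := φ) (u := u) hw
  have htc {w} (hw : IsTestCovector w) := hasCompactSupport_translationFlux (u := X) hw.2
  refine HasDerivAt.congr_deriv (hd.congr_of_eventuallyEq ?_) ?_
  · filter_upwards [hu.eventually_add_smul (isOpen_offDiagonal hU hV) hX] with s hs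
    exact linBracket_eq_integral_bracketDensity hf hφ hs ha hb
  · rw [← integral_add_mul_invD_add_invD_mul _ (ht ha) (htc ha) (hs hb) (hsc hb)]
    simp only [sub_add_cancel]
    rw [integral_add_mul_invD_add_invD_mul _ (hs ha) (hsc ha) (ht hb) (htc hb),
      integral_add_deriv _ (contDiff_boundaryTerm hf hφ hu hX.1 ha hb)
        (hasCompactSupport_boundaryTerm ha hb)]

theorem hasDerivAt_linBracket_add_smul (hU : IsOpen U) (hV : IsOpen V)
    (hf : ∀ t ∈ U, ContDiffAt ℝ ∞ f t) (hφ : ∀ t ∈ V, ContDiffAt ℝ ∞ φ t)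
    (hu : IsSmoothField (offDiagonal U V) u) (hX : ContDiff ℝ ∞ X) (ha : IsTestCovector a)
    (hb : IsTestCovector b) :
    HasDerivAt (fun s : ℝ => linBracket (chaplyginOperator f φ).toFieldOperator a b (u + s • X))
      (∫ x, bracketGradient f φ u a b x ⬝ᵥ X x) 0 := by
  obtain ⟨Y, hY, hYX, hXY⟩ := exists_isTestCovector_linBracket_add_smul_eq ha hb hX
  simp only [hXY _ (HydroOperator.isGermDependent _)]
  refine (hasDerivAt_linBracket_of_isTestCovector hU hV hf hφ hu hY ha hb).congr_deriv ?_
  refine integral_congr_ae (Eventually.of_forall fun x => ?_)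
  by_cases hx : x ∈ tsupport a ∪ tsupport b
  · simp only [hYX x hx]
  · simp only [bracketGradient_eq_zero_of_notMem hx, zero_dotProduct]

theorem continuous_bracketGradient (hf : ∀ t ∈ U, ContDiffAt ℝ ∞ f t)
    (hφ : ∀ t ∈ V, ContDiffAt ℝ ∞ φ t) (hu : IsSmoothField (offDiagonal U V) u)
    (ha : IsTestCovector a) (hb : IsTestCovector b) :
    Continuous (bracketGradient f φ u a b) := by
  refine continuous_iff_continuousAt.2 fun x => ?_
  have hfx := hf _ (hu.2 x).1
  have hφx := hφ _ (hu.2 x).2.1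
  have := hfx.continuousAt
  have := hφx.continuousAt
  have := (contDiffAt_deriv hfx).continuousAt
  have := (contDiffAt_deriv hφx).continuousAt
  have hT {w} (hw : IsTestCovector w) : ContinuousAt (invD (translationFlux u w)) x :=
    (hasDerivAt_invD_translationFlux hu.1 hw x).continuousAt
  have hS {w} (hw : IsTestCovector w) : ContinuousAt (invD (speedFlux f φ u w)) x :=
    (hasDerivAt_invD_speedFlux hf hφ hu hw x).continuousAt
  have := hT ha
  have := hT hb
  have := hS ha
  have := hS hb
  have := hu.1.continuous
  have := hu.1.continuous_deriv (by simp)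
  have := ha.1.continuous
  have := ha.1.continuous_deriv (by simp)
  have := hb.1.continuous
  have := hb.1.continuous_deriv (by simp)
  refine continuousAt_pi.2 fun i => ?_
  fin_cases i <;>
  · simp only [bracketGradient, localGradient, wronskian, wedge, speed₁, speed₂, Fin.zero_eta,
      Fin.mk_one, Pi.sub_apply, Matrix.cons_val_zero, Matrix.cons_val_one]
    fun_prop

theorem integrable_bracketGradient_dotProduct (hf : ∀ t ∈ U, ContDiffAt ℝ ∞ f t)
    (hφ : ∀ t ∈ V, ContDiffAt ℝ ∞ φ t) (hu : IsSmoothField (offDiagonal U V) u)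
    (ha : IsTestCovector a) (hb : IsTestCovector b) (hX : Continuous X) :
    Integrable fun x => bracketGradient f φ u a b x ⬝ᵥ X x :=
  ((continuous_bracketGradient hf hφ hu ha hb).dotProduct hX).integrable_of_hasCompactSupport <|
    HasCompactSupport.intro (ha.2.isCompact.union hb.2.isCompact) fun x hx => by
      rw [bracketGradient_eq_zero_of_notMem hx, zero_dotProduct]

theorem isHamiltonianOperator_chaplyginOperator (hU : IsOpen U) (hV : IsOpen V)
    (hf : ∀ t ∈ U, ContDiffAt ℝ ∞ f t) (hφ : ∀ t ∈ V, ContDiffAt ℝ ∞ φ t) :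
    IsHamiltonianOperator (offDiagonal U V) (chaplyginOperator f φ).toFieldOperator := by
  have hJ := isSmoothOn_chaplyginOperator hf hφ
  have smooth {u a} (hu : IsSmoothField (offDiagonal U V) u) (ha : IsTestCovector a) :=
    HydroOperator.contDiff_toFieldOperator hJ hu ha
  refine ⟨fun u a hu ha => smooth hu ha,
    fun u a b hu ha hb => HydroOperator.toFieldOperator_add hJ hu ha hb,
    fun _ _ r _ ha => HydroOperator.toFieldOperator_smul ha r,
    fun u a b hu ha hb => ?_, fun u a b c hu ha hb hc => ?_⟩
  · rw [linBracket_eq_integral_bracketDensity hf hφ hu ha hb,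
      linBracket_eq_integral_bracketDensity hf hφ hu hb ha, ← integral_neg]
    simp only [bracketDensity_swap (a := a), neg_neg]
  · have hab := integrable_bracketGradient_dotProduct hf hφ hu ha hb (smooth hu hc).continuous
    have hbc := integrable_bracketGradient_dotProduct hf hφ hu hb hc (smooth hu ha).continuous
    have hca := integrable_bracketGradient_dotProduct hf hφ hu hc ha (smooth hu hb).continuous
    refine ⟨_, _, _, hasDerivAt_linBracket_add_smul hU hV hf hφ hu (smooth hu hc) ha hb,
      hasDerivAt_linBracket_add_smul hU hV hf hφ hu (smooth hu ha) hb hc,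
      hasDerivAt_linBracket_add_smul hU hV hf hφ hu (smooth hu hb) hc ha, ?_⟩
    rw [← integral_add' hab hbc, ← integral_add' (hab.add hbc) hca]
    simp only [Pi.add_apply, bracketGradient_jacobi, integral_zero]

end Jacobi

section LinearCombination

variable {U V : Set ℝ} {f f₁ f₂ φ φ₁ φ₂ : ℝ → ℝ} {u a : ℝ → Fin 2 → ℝ}

theorem Admissible.contDiffAt (hU : IsOpen U) (hf : Admissible U f) :
    ∀ t ∈ U, ContDiffAt ℝ ∞ f t :=
  fun _ ht => hf.1.contDiffAt (hU.mem_nhds ht)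

theorem deriv_linear_combination {t : ℝ} (h₁ : ContDiffAt ℝ ∞ f₁ t) (h₂ : ContDiffAt ℝ ∞ f₂ t)
    (c₁ c₂ : ℝ) : deriv (c₁ • f₁ + c₂ • f₂) t = c₁ * deriv f₁ t + c₂ * deriv f₂ t :=
  (((hasDerivAt_of_contDiffAt h₁).const_smul c₁).add
    ((hasDerivAt_of_contDiffAt h₂).const_smul c₂)).deriv

theorem speed₁_linear_combination {p : Fin 2 → ℝ} (h₁ : ContDiffAt ℝ ∞ f₁ (p 0))
    (h₂ : ContDiffAt ℝ ∞ f₂ (p 0)) (c₁ c₂ : ℝ) :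
    speed₁ (c₁ • f₁ + c₂ • f₂) (c₁ • φ₁ + c₂ • φ₂) p =
      c₁ * speed₁ f₁ φ₁ p + c₂ * speed₁ f₂ φ₂ p := by
  simp only [speed₁, deriv_linear_combination h₁ h₂, Pi.add_apply, Pi.smul_apply, smul_eq_mul]
  ring

theorem speed₂_linear_combination {p : Fin 2 → ℝ} (h₁ : ContDiffAt ℝ ∞ φ₁ (p 1))
    (h₂ : ContDiffAt ℝ ∞ φ₂ (p 1)) (c₁ c₂ : ℝ) :
    speed₂ (c₁ • f₁ + c₂ • f₂) (c₁ • φ₁ + c₂ • φ₂) p =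
      c₁ * speed₂ f₁ φ₁ p + c₂ * speed₂ f₂ φ₂ p := by
  simp only [speed₂, deriv_linear_combination h₁ h₂, Pi.add_apply, Pi.smul_apply, smul_eq_mul]
  ring

theorem invD_speedFlux_linear_combination (hf₁ : ∀ t ∈ U, ContDiffAt ℝ ∞ f₁ t)
    (hφ₁ : ∀ t ∈ V, ContDiffAt ℝ ∞ φ₁ t) (hf₂ : ∀ t ∈ U, ContDiffAt ℝ ∞ f₂ t)
    (hφ₂ : ∀ t ∈ V, ContDiffAt ℝ ∞ φ₂ t) (hu : IsSmoothField (offDiagonal U V) u)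
    (ha : IsTestCovector a) (c₁ c₂ : ℝ) :
    invD (speedFlux (c₁ • f₁ + c₂ • f₂) (c₁ • φ₁ + c₂ • φ₂) u a) =
      c₁ • invD (speedFlux f₁ φ₁ u a) + c₂ • invD (speedFlux f₂ φ₂ u a) := by
  have hi {f φ : ℝ → ℝ} (hf : ∀ t ∈ U, ContDiffAt ℝ ∞ f t) (hφ : ∀ t ∈ V, ContDiffAt ℝ ∞ φ t) :
      Integrable (speedFlux f φ u a) :=
    (contDiff_speedFlux hf hφ hu ha).continuous.integrable_of_hasCompactSupport
      (hasCompactSupport_speedFlux ha)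
  rw [← invD_smul, ← invD_smul, ← invD_add ((hi hf₁ hφ₁).smul c₁) ((hi hf₂ hφ₂).smul c₂)]
  congr 1
  ext x
  simp only [speedFlux, speed₁_linear_combination (hf₁ _ (hu.2 x).1) (hf₂ _ (hu.2 x).1),
    speed₂_linear_combination (hφ₁ _ (hu.2 x).2.1) (hφ₂ _ (hu.2 x).2.1), Pi.add_apply,
    Pi.smul_apply, smul_eq_mul]
  ring

theorem sameOperatorOn_linear_combination (hf₁ : ∀ t ∈ U, ContDiffAt ℝ ∞ f₁ t)
    (hφ₁ : ∀ t ∈ V, ContDiffAt ℝ ∞ φ₁ t) (hf₂ : ∀ t ∈ U, ContDiffAt ℝ ∞ f₂ t)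
    (hφ₂ : ∀ t ∈ V, ContDiffAt ℝ ∞ φ₂ t) (c₁ c₂ : ℝ) :
    SameOperatorOn (offDiagonal U V)
      (chaplyginOperator (c₁ • f₁ + c₂ • f₂) (c₁ • φ₁ + c₂ • φ₂)).toFieldOperator
      (c₁ • (chaplyginOperator f₁ φ₁).toFieldOperator +
        c₂ • (chaplyginOperator f₂ φ₂).toFieldOperator) := by
  intro u a hu ha
  ext x i
  have hf₁x := hf₁ _ (hu.2 x).1
  have hf₂x := hf₂ _ (hu.2 x).1
  have hφ₁x := hφ₁ _ (hu.2 x).2.1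
  have hφ₂x := hφ₂ _ (hu.2 x).2.1
  fin_cases i <;>
  · simp only [Fin.zero_eta, Fin.mk_one, Pi.add_apply, Pi.smul_apply, smul_eq_mul,
      chaplyginOperator_apply_zero, chaplyginOperator_apply_one,
      deriv_linear_combination hf₁x hf₂x, deriv_linear_combination hφ₁x hφ₂x,
      speed₁_linear_combination hf₁x hf₂x, speed₂_linear_combination hφ₁x hφ₂x,
      invD_speedFlux_linear_combination hf₁ hφ₁ hf₂ hφ₂ hu ha]
    ring

theorem compatible_chaplyginOperator (hU : IsOpen U) (hV : IsOpen V)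
    (hf₁ : ∀ t ∈ U, ContDiffAt ℝ ∞ f₁ t) (hφ₁ : ∀ t ∈ V, ContDiffAt ℝ ∞ φ₁ t)
    (hf₂ : ∀ t ∈ U, ContDiffAt ℝ ∞ f₂ t) (hφ₂ : ∀ t ∈ V, ContDiffAt ℝ ∞ φ₂ t) :
    Compatible (offDiagonal U V) (chaplyginOperator f₁ φ₁).toFieldOperator
      (chaplyginOperator f₂ φ₂).toFieldOperator := by
  intro c₁ c₂
  have germ (f φ : ℝ → ℝ) := HydroOperator.isGermDependent (chaplyginOperator f φ)
  exact IsHamiltonianOperator.congr (isOpen_offDiagonal hU hV) (germ _ _)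
    ((germ f₁ φ₁).linear_combination (germ f₂ φ₂) c₁ c₂)
    (sameOperatorOn_linear_combination hf₁ hφ₁ hf₂ hφ₂ c₁ c₂)
    (isHamiltonianOperator_chaplyginOperator hU hV
      (fun t ht => ((hf₁ t ht).const_smul c₁).add ((hf₂ t ht).const_smul c₂))
      (fun t ht => ((hφ₁ t ht).const_smul c₁).add ((hφ₂ t ht).const_smul c₂)))

end LinearCombination

section PartialDerivatives

variable {n : ℕ} {g h : (Fin n → ℝ) → ℝ} {p : Fin n → ℝ}

theorem hasDerivAt_comp_update (hh : DifferentiableAt ℝ h p) (i : Fin n) :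
    HasDerivAt (fun t => h (Function.update p i t)) (pderiv i h p) (p i) := by
  have hh' : HasFDerivAt h (fderiv ℝ h p) (Function.update p i (p i)) := by
    simpa using hh.hasFDerivAt
  exact hh'.comp_hasDerivAt (p i) (hasDerivAt_update p i (p i))

theorem pderiv_eq_of_hasDerivAt_update {i : Fin n} {d : ℝ} (hh : DifferentiableAt ℝ h p)
    (hd : HasDerivAt (fun t => h (Function.update p i t)) d (p i)) : pderiv i h p = d :=
  (hasDerivAt_comp_update hh i).unique hd

theorem fderiv_apply_eq_sum_pderiv (h : (Fin n → ℝ) → ℝ) (p ξ : Fin n → ℝ) :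
    fderiv ℝ h p ξ = ∑ i, pderiv i h p * ξ i := by
  conv_lhs => rw [pi_eq_sum_univ' ξ, map_sum]
  simp only [map_smul, smul_eq_mul, pderiv, mul_comm]

theorem pderiv_const (i : Fin n) (r : ℝ) (p : Fin n → ℝ) : pderiv i (fun _ => r) p = 0 := by
  simp [pderiv]

theorem pderiv_inv (hh : DifferentiableAt ℝ h p) (hp : h p ≠ 0) (i : Fin n) :
    pderiv i (fun q => (h q)⁻¹) p = -pderiv i h p / h p ^ 2 := by
  refine pderiv_eq_of_hasDerivAt_update (hh.inv hp) ?_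
  simpa using (hasDerivAt_comp_update hh i).fun_inv (by simpa using hp)

theorem pderiv_coord (i j : Fin n) (p : Fin n → ℝ) :
    pderiv i (fun q => q j) p = (Pi.single i 1 : Fin n → ℝ) j := by
  rw [pderiv, (hasFDerivAt_apply j p).fderiv, ContinuousLinearMap.proj_apply]

theorem pderiv_sub (hg : DifferentiableAt ℝ g p) (hh : DifferentiableAt ℝ h p) (i : Fin n) :
    pderiv i (fun q => g q - h q) p = pderiv i g p - pderiv i h p := by
  rw [pderiv, fderiv_fun_sub hg hh, sub_apply, pderiv, pderiv]

theorem pderiv_mul (hg : DifferentiableAt ℝ g p) (hh : DifferentiableAt ℝ h p) (i : Fin n) :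
    pderiv i (fun q => g q * h q) p = g p * pderiv i h p + h p * pderiv i g p := by
  simp only [pderiv, fderiv_fun_mul hg hh, add_apply, smul_apply, smul_eq_mul]

theorem differentiableAt_of_contDiffOn {Ω : Set (Fin n → ℝ)} (hΩ : IsOpen Ω)
    (hh : ContDiffOn ℝ ∞ h Ω) (hp : p ∈ Ω) : DifferentiableAt ℝ h p :=
  (hh.contDiffAt (hΩ.mem_nhds hp)).differentiableAt (by simp)

theorem contDiffOn_pderiv {Ω : Set (Fin n → ℝ)} (hΩ : IsOpen Ω) (hh : ContDiffOn ℝ ∞ h Ω)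
    (i : Fin n) : ContDiffOn ℝ ∞ (pderiv i h) Ω :=
  (hh.fderiv_of_isOpen hΩ (m := ∞) (by simp)).clm_apply contDiffOn_const

theorem pderiv_comm (hh : ContDiffAt ℝ ∞ h p) (i j : Fin n) :
    pderiv i (pderiv j h) p = pderiv j (pderiv i h) p := by
  have hd : DifferentiableAt ℝ (fderiv ℝ h) p :=
    (hh.fderiv_right (m := ∞) (by simp)).differentiableAt (by simp)
  have pderiv_pderiv (i j : Fin n) : pderiv i (pderiv j h) p =
      fderiv ℝ (fderiv ℝ h) p (Pi.single i 1) (Pi.single j 1) := by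
    change fderiv ℝ (fun q => fderiv ℝ h q (Pi.single j 1)) p (Pi.single i 1) = _
    rw [(hd.hasFDerivAt.clm_apply (hasFDerivAt_const _ p)).fderiv]
    simp
  rw [pderiv_pderiv, pderiv_pderiv]
  exact hh.isSymmSndFDerivAt
    (by rw [minSmoothness_of_isRCLikeNormedField]; exact ENat.LEInfty.out) _ _

theorem pderiv_eq_zero_of_eqOn_line {I : Set ℝ} (hI : IsOpen I) {i : Fin n}
    (hh : DifferentiableAt ℝ h p) (hp : p i ∈ I)
    (h₀ : ∀ t ∈ I, h (Function.update p i t) = 0) : pderiv i h p = 0 := by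
  refine pderiv_eq_of_hasDerivAt_update hh
    ((hasDerivAt_const (p i) (0 : ℝ)).congr_of_eventuallyEq ?_)
  filter_upwards [hI.mem_nhds hp] with t ht using h₀ t ht

theorem apply_update_eq_of_pderiv_eq_zero {I : Set ℝ} (hI : IsOpen I) (hI' : I.OrdConnected)
    {i : Fin n} (hh : ∀ t ∈ I, DifferentiableAt ℝ h (Function.update p i t))
    (h₀ : ∀ t ∈ I, pderiv i h (Function.update p i t) = 0) {s t : ℝ} (hs : s ∈ I) (ht : t ∈ I) :
    h (Function.update p i s) = h (Function.update p i t) := by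
  have hasDerivAt_zero (r : ℝ) (hr : r ∈ I) :
      HasDerivAt (fun r => h (Function.update p i r)) 0 r := by
    simpa [h₀ r hr] using hasDerivAt_comp_update (hh r hr) (i := i)
  exact hI.is_const_of_deriv_eq_zero hI'.isPreconnected
    (fun r hr => (hasDerivAt_zero r hr).differentiableAt.differentiableWithinAt)
    (fun r hr => (hasDerivAt_zero r hr).deriv) hs ht

end PartialDerivatives

section Metric

theorem christoffel_diagonal_inv {n : ℕ} {h : Fin n → (Fin n → ℝ) → ℝ} {p : Fin n → ℝ}
    (hh : ∀ i, DifferentiableAt ℝ (h i) p) (hp : ∀ i, h i p ≠ 0) (k i j : Fin n) :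
    christoffel (fun q => Matrix.diagonal fun i => (h i q)⁻¹) p k i j =
      (1 / 2) * h k p * ((if i = j then pderiv k (h i) p / h i p ^ 2 else 0) -
        (if k = j then pderiv i (h k) p / h k p ^ 2 else 0) -
        if k = i then pderiv j (h k) p / h k p ^ 2 else 0) := by
  have inv_eq : (Matrix.diagonal fun i => (h i p)⁻¹)⁻¹ = Matrix.diagonal fun i => h i p :=
    Matrix.inv_eq_right_inv (by simp [hp])
  have pderiv_entry (i j k : Fin n) :
      pderiv k (fun q => (Matrix.diagonal fun i => (h i q)⁻¹ : Matrix (Fin n) (Fin n) ℝ) i j) p =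
        if i = j then -pderiv k (h i) p / h i p ^ 2 else 0 := by
    by_cases hij : i = j
    · simp only [hij, Matrix.diagonal_apply_eq, pderiv_inv (hh j) (hp j), if_true]
    · simp only [Matrix.diagonal_apply_ne _ hij, pderiv_const, if_neg hij]
  simp only [christoffel, inv_eq, pderiv_entry]
  simp only [Matrix.diagonal_apply, ite_mul, zero_mul, Finset.sum_ite_eq, Finset.mem_univ, if_true,
    neg_div, mul_assoc]
  split_ifs <;> ring

variable {U V : Set ℝ} {f φ : ℝ → ℝ}

theorem pderiv_sq_sub_mul_comp {f : ℝ → ℝ} {p : Fin 2 → ℝ} {i : Fin 2}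
    (hf : DifferentiableAt ℝ f (p i)) (j : Fin 2) :
    pderiv j (fun q => (q 0 - q 1) ^ 2 * f (q i)) p =
      2 * (p 0 - p 1) * ((Pi.single j 1 : Fin 2 → ℝ) 0 - (Pi.single j 1 : Fin 2 → ℝ) 1) * f (p i) +
        (p 0 - p 1) ^ 2 * (deriv f (p i) * (Pi.single j 1 : Fin 2 → ℝ) i) := by
  have hc (k : Fin 2) : HasDerivAt (fun t => Function.update p j t k)
      ((Pi.single j 1 : Fin 2 → ℝ) k) (p j) := hasDerivAt_pi.1 (hasDerivAt_update p j (p j)) k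
  have hf' : HasDerivAt f (deriv f (p i)) (Function.update p j (p j) i) := by
    simpa using hf.hasDerivAt
  refine pderiv_eq_of_hasDerivAt_update (by fun_prop) (HasDerivAt.congr_deriv
    ((((hc 0).sub (hc 1)).pow 2).mul (hf'.comp (p j) (hc i))) ?_)
  simp

theorem chaplyginMetric_eq_diagonal_inv :
    chaplyginMetric f φ = fun p => Matrix.diagonal fun i =>
      ((p 0 - p 1) ^ 2 * (![f, φ] : Fin 2 → ℝ → ℝ) i (p i))⁻¹ := by
  ext p i j
  fin_cases i <;> fin_cases j <;> simp [chaplyginMetric]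

theorem localPartOfMetric_chaplyginOperator (hU : IsOpen U) (hV : IsOpen V) (hf : Admissible U f)
    (hφ : Admissible V φ) :
    LocalPartOfMetric (offDiagonal U V) (chaplyginOperator f φ) (chaplyginMetric f φ) := by
  intro p hp
  have hd : p 0 - p 1 ≠ 0 := sub_ne_zero.2 hp.2.2
  have hfp := hf.2 _ hp.1
  have hφp := hφ.2 _ hp.2.1
  have hdiff (i : Fin 2) : DifferentiableAt ℝ ((![f, φ] : Fin 2 → ℝ → ℝ) i) (p i) := by
    fin_cases i
    exacts [(hf.contDiffAt hU _ hp.1).differentiableAt (by simp),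
      (hφ.contDiffAt hV _ hp.2.1).differentiableAt (by simp)]
  have hne (i : Fin 2) : (p 0 - p 1) ^ 2 * (![f, φ] : Fin 2 → ℝ → ℝ) i (p i) ≠ 0 := by
    fin_cases i
    exacts [mul_ne_zero (pow_ne_zero 2 hd) hfp, mul_ne_zero (pow_ne_zero 2 hd) hφp]
  have christoffel_eq := christoffel_diagonal_inv (p := p)
    (h := fun i q => (q 0 - q 1) ^ 2 * (![f, φ] : Fin 2 → ℝ → ℝ) i (q i))
    (fun i => by have := hdiff i; fun_prop) hne
  have inv_eq : (chaplyginMetric f φ p)⁻¹ = (chaplyginOperator f φ).lead p := by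
    refine Matrix.inv_eq_right_inv ?_
    ext i j
    fin_cases i <;> fin_cases j <;> simp [chaplyginMetric, chaplyginOperator] <;> field_simp
  refine ⟨?_, ?_, inv_eq.symm, fun ξ i j => ?_⟩
  · rw [chaplyginMetric_eq_diagonal_inv]
    exact Matrix.isSymm_diagonal _
  · rw [chaplyginMetric_eq_diagonal_inv, Matrix.det_diagonal]
    exact Finset.prod_ne_zero_iff.2 fun i _ => inv_ne_zero (hne i)
  · rw [inv_eq]
    simp only [chaplyginMetric_eq_diagonal_inv, christoffel_eq,
      pderiv_sq_sub_mul_comp (hdiff _), Fin.sum_univ_two]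
    fin_cases i <;> fin_cases j <;> simp [chaplyginOperator] <;> field_simp <;> ring

end Metric

section Flows

variable {n : ℕ} {Ω : Set (Fin n → ℝ)} {V W : (Fin n → ℝ) → Matrix (Fin n) (Fin n) ℝ}
  {u : ℝ → Fin n → ℝ} {x : ℝ}

/-- The derivative of the right-hand side `V(u) uₓ` in the direction `W(u) uₓ`, as a function of
the values `p`, `ξ`, `η` of `u`, `uₓ`, `uₓₓ`. -/
noncomputable def flowVariation (V W : (Fin n → ℝ) → Matrix (Fin n) (Fin n) ℝ)
    (p ξ η : Fin n → ℝ) (i : Fin n) : ℝ :=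
  ∑ j, (fderiv ℝ (fun q => V q i j) p (W p *ᵥ ξ) * ξ j +
    V p i j * ∑ k, (fderiv ℝ (fun q => W q j k) p ξ * ξ k + W p j k * η k))

theorem hasDerivAt_hydroFlow (hu : ContDiff ℝ ∞ u)
    (hW : ∀ i j, DifferentiableAt ℝ (fun p => W p i j) (u x)) :
    HasDerivAt (hydroFlow W u) (fun i => ∑ k, (fderiv ℝ (fun q => W q i k) (u x) (deriv u x) *
      deriv u x k + W (u x) i k * deriv (deriv u) x k)) x := by
  refine hasDerivAt_pi.2 fun i => ?_
  simp only [hydroFlow, Matrix.mulVec, dotProduct]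
  exact HasDerivAt.fun_sum fun k _ =>
    ((hW i k).hasFDerivAt.comp_hasDerivAt x (hu.differentiable (by simp) x).hasDerivAt).mul
      (hasDerivAt_coord (hu.iterate_deriv 1) k x)

theorem hasDerivAt_hydroFlow_add_smul (hu : ContDiff ℝ ∞ u)
    (hV : ∀ i j, DifferentiableAt ℝ (fun p => V p i j) (u x))
    (hW : ∀ i j, DifferentiableAt ℝ (fun p => W p i j) (u x)) :
    HasDerivAt (fun s : ℝ => hydroFlow V (u + s • hydroFlow W u) x)
      (flowVariation V W (u x) (deriv u x) (deriv (deriv u) x)) 0 := by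
  have hY := hasDerivAt_hydroFlow hu hW
  set Y := hydroFlow W u
  have hline (p q : Fin n → ℝ) : HasDerivAt (fun s : ℝ => p + s • q) q 0 := by
    simpa using ((hasDerivAt_id (0 : ℝ)).smul_const q).const_add p
  have hderiv (s : ℝ) : deriv (u + s • Y) x = deriv u x + s • deriv Y x := by
    rw [hY.deriv]
    exact ((hu.differentiable (by simp) x).hasDerivAt.add (hY.const_smul s)).deriv
  refine hasDerivAt_pi.2 fun i => ?_
  simp only [hydroFlow, Matrix.mulVec, dotProduct, hderiv, Pi.add_apply (f := u)]
  refine HasDerivAt.fun_sum fun j _ => ?_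
  have hV' : HasFDerivAt (fun p => V p i j) (fderiv ℝ (fun p => V p i j) (u x))
      (u x + (0 : ℝ) • Y x) := by
    simpa using (hV i j).hasFDerivAt
  refine ((hV'.comp_hasDerivAt (0 : ℝ) (hline _ _)).mul
    (hasDerivAt_pi.1 (hline _ _) j)).congr_deriv ?_
  simp [hY.deriv, Y, hydroFlow]

theorem exists_isSmoothField_eventuallyEq (hΩ : IsOpen Ω) {q : ℝ → Fin n → ℝ}
    (hq : ContDiff ℝ ∞ q) (h₀ : q 0 ∈ Ω) : ∃ u, IsSmoothField Ω u ∧ u =ᶠ[𝓝 0] q := by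
  obtain ⟨δ, hδ, hball⟩ := Metric.mem_nhds_iff.1 (hq.continuous.continuousAt.preimage_mem_nhds
    (hΩ.mem_nhds h₀))
  let χ : ContDiffBump (0 : ℝ) := ⟨δ / 2, δ, half_pos hδ, half_lt_self hδ⟩
  refine ⟨fun x => q (χ x * x), ⟨hq.comp (χ.contDiff.mul contDiff_id), fun x => hball ?_⟩, ?_⟩
  · by_cases hx : x ∈ Metric.ball 0 δ
    · rw [mem_ball_zero_iff, Real.norm_eq_abs] at hx ⊢
      rw [abs_mul, abs_of_nonneg χ.nonneg]
      exact (mul_le_of_le_one_left (abs_nonneg x) χ.le_one).trans_lt hx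
    · have hχ : χ x = 0 := χ.zero_of_le_dist (by simpa using hx)
      simpa [hχ] using hδ
  · filter_upwards [χ.eventuallyEq_one] with x hx
    simp [hx]

theorem exists_isSmoothField_jet (hΩ : IsOpen Ω) {p : Fin n → ℝ} (hp : p ∈ Ω)
    (ξ η : Fin n → ℝ) :
    ∃ u, IsSmoothField Ω u ∧ u 0 = p ∧ deriv u 0 = ξ ∧ deriv (deriv u) 0 = η := by
  set q : ℝ → Fin n → ℝ := fun x => p + (x • ξ + (x ^ 2 / 2) • η)
  have hq (x : ℝ) : HasDerivAt q (ξ + x • η) x := by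
    refine ((((hasDerivAt_id x).smul_const ξ).add
      ((((hasDerivAt_id x).pow 2).div_const 2).smul_const η)).const_add p).congr_deriv ?_
    simp
  have hq' : deriv (deriv q) 0 = η := by
    rw [funext fun x => (hq x).deriv]
    simpa using (((hasDerivAt_id (0 : ℝ)).smul_const η).const_add ξ).deriv
  obtain ⟨u, hu, huq⟩ := exists_isSmoothField_eventuallyEq hΩ (q := q) (by fun_prop)
    (by simpa [q] using hp)
  exact ⟨u, hu, by simp [huq.eq_of_nhds, q], by simp [huq.deriv_eq, (hq 0).deriv],
    by rw [huq.deriv.deriv_eq, hq']⟩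

theorem flowsCommute_iff (hΩ : IsOpen Ω)
    (hV : ∀ i j, ∀ p ∈ Ω, DifferentiableAt ℝ (fun q => V q i j) p)
    (hW : ∀ i j, ∀ p ∈ Ω, DifferentiableAt ℝ (fun q => W q i j) p) :
    FlowsCommute Ω V W ↔
      ∀ p ∈ Ω, ∀ ξ η, flowVariation V W p ξ η = flowVariation W V p ξ η := by
  have hasDerivAt_VW {u} (hu : IsSmoothField Ω u) (x : ℝ) :=
    hasDerivAt_hydroFlow_add_smul (x := x) hu.1 (fun i j => hV i j _ (hu.2 x))
      fun i j => hW i j _ (hu.2 x)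
  have hasDerivAt_WV {u} (hu : IsSmoothField Ω u) (x : ℝ) :=
    hasDerivAt_hydroFlow_add_smul (x := x) hu.1 (fun i j => hW i j _ (hu.2 x))
      fun i j => hV i j _ (hu.2 x)
  refine ⟨fun h p hp ξ η => ?_, fun h u hu x =>
    ⟨_, hasDerivAt_VW hu x, h _ (hu.2 x) _ _ ▸ hasDerivAt_WV hu x⟩⟩
  obtain ⟨u, hu, rfl, rfl, rfl⟩ := exists_isSmoothField_jet hΩ hp ξ η
  obtain ⟨d, hd, hd'⟩ := h u hu 0
  exact ((hasDerivAt_VW hu 0).unique hd).trans (hd'.unique (hasDerivAt_WV hu 0))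

theorem FlowsCommute.matrix_commute (hΩ : IsOpen Ω)
    (hV : ∀ i j, ∀ p ∈ Ω, DifferentiableAt ℝ (fun q => V q i j) p)
    (hW : ∀ i j, ∀ p ∈ Ω, DifferentiableAt ℝ (fun q => W q i j) p)
    (h : FlowsCommute Ω V W) {p : Fin n → ℝ} (hp : p ∈ Ω) : Commute (V p) (W p) := by
  have flowVariation_zero (V W : (Fin n → ℝ) → Matrix (Fin n) (Fin n) ℝ) (η : Fin n → ℝ) :
      flowVariation V W p 0 η = (V p * W p) *ᵥ η := by
    ext i
    rw [← Matrix.mulVec_mulVec]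
    simp [flowVariation, Matrix.mulVec, dotProduct]
  refine Matrix.toLin'.injective (LinearMap.ext fun η => ?_)
  rw [Matrix.toLin'_apply, Matrix.toLin'_apply, ← flowVariation_zero, ← flowVariation_zero]
  exact (flowsCommute_iff hΩ hV hW).1 h p hp 0 η

theorem FlowsCommute.congr_right {W' : (Fin n → ℝ) → Matrix (Fin n) (Fin n) ℝ} (hΩ : IsOpen Ω)
    (h : FlowsCommute Ω V W) (hW : ∀ p ∈ Ω, W p = W' p) : FlowsCommute Ω V W' := by
  intro u hu x
  obtain ⟨d, hd, hd'⟩ := h u hu x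
  have hflow : hydroFlow W' u = hydroFlow W u :=
    funext fun y => by rw [hydroFlow, hydroFlow, hW _ (hu.2 y)]
  refine ⟨d, hflow ▸ hd, hd'.congr_of_eventuallyEq ?_⟩
  have hline : ContinuousAt (fun s : ℝ => u x + s • hydroFlow V u x) 0 := by fun_prop
  filter_upwards [hline.eventually_mem (hΩ.mem_nhds (by simpa using hu.2 x))] with s hs
  exact congrArg (· *ᵥ _) (hW _ hs).symm

variable {v w : (Fin n → ℝ) → Fin n → ℝ}

theorem flowVariation_diagonal (p ξ η : Fin n → ℝ) (i : Fin n) :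
    flowVariation (fun q => Matrix.diagonal (v q)) (fun q => Matrix.diagonal (w q)) p ξ η i =
      (∑ k, pderiv k (fun q => v q i) p * (w p k * ξ k)) * ξ i +
        v p i * ((∑ k, pderiv k (fun q => w q i) p * ξ k) * ξ i + w p i * η i) := by
  have fderiv_entry (v : (Fin n → ℝ) → Fin n → ℝ) (i j : Fin n) (ζ : Fin n → ℝ) :
      fderiv ℝ (fun q => Matrix.diagonal (v q) i j) p ζ =
        if i = j then ∑ k, pderiv k (fun q => v q i) p * ζ k else 0 := by
    by_cases hij : i = j
    · simp only [hij, Matrix.diagonal_apply_eq, fderiv_apply_eq_sum_pderiv, if_true]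
    · simp [hij]
  simp only [flowVariation, fderiv_entry]
  simp only [Matrix.diagonal_apply, ite_mul, zero_mul, Finset.sum_add_distrib, Finset.sum_ite_eq,
    Finset.mem_univ, if_true, Matrix.mulVec_diagonal]

theorem flowVariation_diagonal_sub (p ξ η : Fin n → ℝ) (i : Fin n) :
    flowVariation (fun q => Matrix.diagonal (v q)) (fun q => Matrix.diagonal (w q)) p ξ η i -
      flowVariation (fun q => Matrix.diagonal (w q)) (fun q => Matrix.diagonal (v q)) p ξ η i =
    ξ i * ∑ k, (pderiv k (fun q => v q i) p * (w p k - w p i) -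
      pderiv k (fun q => w q i) p * (v p k - v p i)) * ξ k := by
  simp only [flowVariation_diagonal, sub_mul, mul_sub, Finset.sum_sub_distrib, Finset.mul_sum,
    mul_add, mul_assoc, mul_left_comm, mul_comm]
  ring

/-- Tsarev's criterion. -/
theorem flowsCommute_diagonal_iff (hΩ : IsOpen Ω)
    (hv : ∀ i, ∀ p ∈ Ω, DifferentiableAt ℝ (fun q => v q i) p)
    (hw : ∀ i, ∀ p ∈ Ω, DifferentiableAt ℝ (fun q => w q i) p) :
    FlowsCommute Ω (fun p => Matrix.diagonal (v p)) (fun p => Matrix.diagonal (w p)) ↔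
      ∀ p ∈ Ω, ∀ i k, pderiv k (fun q => v q i) p * (w p k - w p i) =
        pderiv k (fun q => w q i) p * (v p k - v p i) := by
  have differentiableAt_entry {v : (Fin n → ℝ) → Fin n → ℝ}
      (hv : ∀ i, ∀ p ∈ Ω, DifferentiableAt ℝ (fun q => v q i) p) (i j : Fin n) :
      ∀ p ∈ Ω, DifferentiableAt ℝ (fun q => Matrix.diagonal (v q) i j) p := by
    intro p hp
    by_cases hij : i = j
    · simpa [hij] using hv j p hp
    · simp [Matrix.diagonal_apply_ne _ hij]
  rw [flowsCommute_iff hΩ (differentiableAt_entry hv) (differentiableAt_entry hw)]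
  refine forall₂_congr fun p _ => ⟨fun h i k => ?_, fun h ξ η => funext fun i => ?_⟩
  · by_cases hik : i = k
    · simp [hik]
    have hi := flowVariation_diagonal_sub (v := v) (w := w) p (Pi.single i 1 + Pi.single k 1) 0 i
    rw [h, sub_self] at hi
    simpa [Pi.single_apply, hik, mul_add, Finset.sum_add_distrib, sub_eq_zero] using hi.symm
  · rw [← sub_eq_zero, flowVariation_diagonal_sub]
    simp [h]

end Flows

section CommutingFlow

variable {U V : Set ℝ} {f φ : ℝ → ℝ} {w₁ w₂ : (Fin 2 → ℝ) → ℝ}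

/-- The equations on the speeds `w₁`, `w₂` of a diagonal flow expressing that it commutes with the
system `uₜ = v uₓ`, `vₜ = u vₓ`. -/
def IsCommutingSpeed (Ω : Set (Fin 2 → ℝ)) (w₁ w₂ : (Fin 2 → ℝ) → ℝ) : Prop :=
  ∀ p ∈ Ω, (p 0 - p 1) * pderiv 1 w₁ p = w₂ p - w₁ p ∧
    (p 0 - p 1) * pderiv 0 w₂ p = w₂ p - w₁ p

theorem chaplyginMatrix_eq_diagonal : chaplyginMatrix = fun p => Matrix.diagonal ![p 1, p 0] := by
  ext p i j
  fin_cases i <;> fin_cases j <;> rfl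

theorem speedMatrix_eq_diagonal :
    speedMatrix f φ = fun p => Matrix.diagonal ![speed₁ f φ p, speed₂ f φ p] := by
  ext p i j
  fin_cases i <;> fin_cases j <;> rfl

theorem flowsCommute_chaplyginMatrix_diagonal_iff (hU : IsOpen U) (hV : IsOpen V)
    (hw₁ : ∀ p ∈ offDiagonal U V, DifferentiableAt ℝ w₁ p)
    (hw₂ : ∀ p ∈ offDiagonal U V, DifferentiableAt ℝ w₂ p) :
    FlowsCommute (offDiagonal U V) chaplyginMatrix (fun p => Matrix.diagonal ![w₁ p, w₂ p]) ↔
      IsCommutingSpeed (offDiagonal U V) w₁ w₂ := by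
  rw [chaplyginMatrix_eq_diagonal, flowsCommute_diagonal_iff (isOpen_offDiagonal hU hV)
    (fun i p _ => by fin_cases i <;> exact differentiableAt_apply _ _)
    (fun i p hp => by fin_cases i; exacts [hw₁ p hp, hw₂ p hp])]
  refine forall₂_congr fun p _ => ?_
  simp only [Fin.forall_fin_two, Matrix.cons_val_zero, Matrix.cons_val_one, pderiv_coord,
    Pi.single_eq_same, sub_self, mul_zero, true_and, and_true, one_mul]
  constructor <;> rintro ⟨h₁, h₂⟩ <;> constructor <;> linarith

theorem pderiv_one_speed₁ {p : Fin 2 → ℝ} (hf : ContDiffAt ℝ ∞ f (p 0))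
    (hφ : ContDiffAt ℝ ∞ φ (p 1)) :
    pderiv 1 (speed₁ f φ) p = -(deriv f (p 0) + deriv φ (p 1)) / 2 := by
  refine pderiv_eq_of_hasDerivAt_update ((contDiffAt_speed₁ hf hφ).differentiableAt (by simp))
    ((hasDerivAt_speed₁_comp (γ := Function.update p 1) (by simpa using hf) (by simpa using hφ)
      (hasDerivAt_update p 1 (p 1))).congr_deriv ?_)
  simp

theorem pderiv_zero_speed₂ {p : Fin 2 → ℝ} (hf : ContDiffAt ℝ ∞ f (p 0))
    (hφ : ContDiffAt ℝ ∞ φ (p 1)) :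
    pderiv 0 (speed₂ f φ) p = -(deriv f (p 0) + deriv φ (p 1)) / 2 := by
  refine pderiv_eq_of_hasDerivAt_update ((contDiffAt_speed₂ hf hφ).differentiableAt (by simp))
    ((hasDerivAt_speed₂_comp (γ := Function.update p 0) (by simpa using hf) (by simpa using hφ)
      (hasDerivAt_update p 0 (p 0))).congr_deriv ?_)
  simp

theorem isCommutingSpeed_speed (hf : ∀ t ∈ U, ContDiffAt ℝ ∞ f t)
    (hφ : ∀ t ∈ V, ContDiffAt ℝ ∞ φ t) :
    IsCommutingSpeed (offDiagonal U V) (speed₁ f φ) (speed₂ f φ) := by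
  intro p hp
  rw [pderiv_one_speed₁ (hf _ hp.1) (hφ _ hp.2.1), pderiv_zero_speed₂ (hf _ hp.1) (hφ _ hp.2.1),
    speed₁, speed₂]
  constructor <;> ring

theorem flowsCommute_chaplyginMatrix_speedMatrix (hU : IsOpen U) (hV : IsOpen V)
    (hf : ∀ t ∈ U, ContDiffAt ℝ ∞ f t) (hφ : ∀ t ∈ V, ContDiffAt ℝ ∞ φ t) :
    FlowsCommute (offDiagonal U V) chaplyginMatrix (speedMatrix f φ) := by
  rw [speedMatrix_eq_diagonal, flowsCommute_chaplyginMatrix_diagonal_iff hU hV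
    (fun p hp => (contDiffAt_speed₁ (hf _ hp.1) (hφ _ hp.2.1)).differentiableAt (by simp))
    (fun p hp => (contDiffAt_speed₂ (hf _ hp.1) (hφ _ hp.2.1)).differentiableAt (by simp))]
  exact isCommutingSpeed_speed hf hφ

end CommutingFlow

section RootPrimitive

variable {U : Set ℝ} {f F : ℝ → ℝ} {t : ℝ}

theorem abs_eq_sign_mul_self (r : ℝ) : |r| = Real.sign r * r := by
  rcases lt_trichotomy r 0 with h | rfl | h
  · rw [Real.sign_of_neg h, abs_of_neg h, neg_one_mul]
  · simp
  · rw [Real.sign_of_pos h, abs_of_pos h, one_mul]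

theorem eventually_sign_eq (hf : ContinuousAt f t) (h₀ : f t ≠ 0) :
    ∀ᶠ s in 𝓝 t, Real.sign (f s) = Real.sign (f t) := by
  rcases h₀.lt_or_gt with h | h
  · filter_upwards [hf.eventually_lt continuousAt_const h] with s hs
    rw [Real.sign_of_neg hs, Real.sign_of_neg h]
  · filter_upwards [continuousAt_const.eventually_lt hf h] with s hs
    rw [Real.sign_of_pos hs, Real.sign_of_pos h]

theorem hasDerivAt_sqrt_abs (hf : DifferentiableAt ℝ f t) (h₀ : f t ≠ 0) :
    HasDerivAt (fun s => √|f s|) (Real.sign (f t) * deriv f t / (2 * √|f t|)) t := by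
  refine HasDerivAt.sqrt ((hf.hasDerivAt.const_mul (Real.sign (f t))).congr_of_eventuallyEq ?_)
    (abs_ne_zero.2 h₀)
  filter_upwards [eventually_sign_eq hf.continuousAt h₀] with s hs
  rw [← hs, abs_eq_sign_mul_self]

theorem IsRootPrimitive.hasDerivAt_sign_mul_sq (hF : IsRootPrimitive U f F) (ht : t ∈ U)
    (hf : ContinuousAt f t) (h₀ : f t ≠ 0) :
    HasDerivAt (fun s => Real.sign (f s) * F s ^ 2) (2 * Real.sign (f t) * (F t / √|f t|)) t := by
  refine (((hF t ht).pow 2).const_mul (Real.sign (f t))).congr_of_eventuallyEq ?_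
    |>.congr_deriv ?_
  · filter_upwards [eventually_sign_eq hf h₀] with s hs
    rw [hs, Pi.pow_apply]
  · push_cast
    ring

theorem IsRootPrimitive.contDiffOn (hU : IsOpen U) (hF : IsRootPrimitive U f F)
    (hf : Admissible U f) : ContDiffOn ℝ ∞ F U := by
  refine (contDiffOn_infty_iff_deriv_of_isOpen hU).2
    ⟨fun t ht => (hF t ht).differentiableAt.differentiableWithinAt, ?_⟩
  refine ContDiffOn.congr (f := fun t => 1 / √|f t|) (fun t ht => ?_) fun t ht => (hF t ht).deriv
  exact (contDiffAt_const.div (((hf.contDiffAt hU t ht).abs (hf.2 t ht)).sqrt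
    (abs_ne_zero.2 (hf.2 t ht))) (Real.sqrt_ne_zero'.2 (abs_pos.2 (hf.2 t ht)))).contDiffWithinAt

theorem IsRootPrimitive.contDiffAt_sign_mul_sq (hU : IsOpen U) (hF : IsRootPrimitive U f F)
    (hf : Admissible U f) :
    ∀ t ∈ U, ContDiffAt ℝ ∞ (fun s => Real.sign (f s) * F s ^ 2) t := by
  intro t ht
  refine (contDiffAt_const.mul (((hF.contDiffOn hU hf).contDiffAt (hU.mem_nhds ht)).pow 2)
    ).congr_of_eventuallyEq (f := fun s => Real.sign (f t) * F s ^ 2) ?_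
  filter_upwards [eventually_sign_eq (hf.contDiffAt hU t ht).continuousAt (hf.2 t ht)] with s hs
  rw [hs]

theorem IsRootPrimitive.deriv_deriv_sign_mul_sq (hU : IsOpen U) (hF : IsRootPrimitive U f F)
    (hf : Admissible U f) : ∀ t ∈ U, f t * deriv (deriv fun s => Real.sign (f s) * F s ^ 2) t =
      2 - deriv f t * deriv (fun s => Real.sign (f s) * F s ^ 2) t / 2 := by
  intro t ht
  have continuousAt (s) (hs : s ∈ U) := (hf.contDiffAt hU s hs).continuousAt
  have hr : √|f t| ≠ 0 := Real.sqrt_ne_zero'.2 (abs_pos.2 (hf.2 t ht))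
  have hG' : deriv (fun s => Real.sign (f s) * F s ^ 2) =ᶠ[𝓝 t]
      fun s => 2 * Real.sign (f t) * (F s / √|f s|) := by
    filter_upwards [hU.mem_nhds ht, eventually_sign_eq (continuousAt t ht) (hf.2 t ht)]
      with s hs hsign
    rw [(hF.hasDerivAt_sign_mul_sq hs (continuousAt s hs) (hf.2 s hs)).deriv, hsign]
  have hG'' := ((hF t ht).fun_div (hasDerivAt_sqrt_abs
    ((hf.contDiffAt hU t ht).differentiableAt (by simp)) (hf.2 t ht)) hr).const_mul
      (2 * Real.sign (f t))
  have sign_sq : Real.sign (f t) ^ 2 = 1 := by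
    rcases Real.sign_apply_eq_of_ne_zero _ (hf.2 t ht) with h | h <;> simp [h]
  have f_eq : f t = Real.sign (f t) * √|f t| ^ 2 := by
    rw [Real.sq_sqrt (abs_nonneg _), abs_eq_sign_mul_self]
    linear_combination -f t * sign_sq
  rw [hG'.deriv_eq, hG''.deriv, hG'.eq_of_nhds]
  generalize Real.sign (f t) = σ, √|f t| = r, deriv f t = f' at *
  rw [f_eq]
  field_simp
  linear_combination (2 * r - F t * f' * σ) * sign_sq

end RootPrimitive

section Density

variable {U V : Set ℝ} {f φ G Γ : ℝ → ℝ} {u : ℝ → Fin 2 → ℝ} {p : Fin 2 → ℝ}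

/-- The function `(G(u) - Γ(v)) / (4 (v - u))`; the density of the system is of this form. -/
noncomputable def quotientDensity (G Γ : ℝ → ℝ) (p : Fin 2 → ℝ) : ℝ :=
  (G (p 0) - Γ (p 1)) / (4 * (p 1 - p 0))

/-- The antiderivative of `w¹ uₓ ∂h/∂u + w² vₓ ∂h/∂v` for the density `h = quotientDensity G Γ`. -/
noncomputable def speedPotential (f φ G Γ : ℝ → ℝ) (p : Fin 2 → ℝ) : ℝ :=
  (p 0 + p 1) / 2 - (f (p 0) * deriv G (p 0) + φ (p 1) * deriv Γ (p 1)) / 4 -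
    (f (p 0) + φ (p 1)) / 2 * quotientDensity G Γ p

theorem contDiffAt_quotientDensity (hG : ContDiffAt ℝ ∞ G (p 0)) (hΓ : ContDiffAt ℝ ∞ Γ (p 1))
    (hp : p 0 ≠ p 1) : ContDiffAt ℝ ∞ (quotientDensity G Γ) p :=
  ContDiffAt.div (by fun_prop) (by fun_prop) (mul_ne_zero four_ne_zero (sub_ne_zero.2 hp.symm))

theorem hasDerivAt_quotientDensity_comp {γ : ℝ → Fin 2 → ℝ} {γ' : Fin 2 → ℝ} {t : ℝ}
    (hG : DifferentiableAt ℝ G (γ t 0)) (hΓ : DifferentiableAt ℝ Γ (γ t 1))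
    (hne : γ t 0 ≠ γ t 1) (hγ : HasDerivAt γ γ' t) :
    HasDerivAt (fun s => quotientDensity G Γ (γ s))
      ((deriv G (γ t 0) / (4 * (γ t 1 - γ t 0)) +
          quotientDensity G Γ (γ t) / (γ t 1 - γ t 0)) * γ' 0 -
        (deriv Γ (γ t 1) / (4 * (γ t 1 - γ t 0)) +
          quotientDensity G Γ (γ t) / (γ t 1 - γ t 0)) * γ' 1) t := by
  have h₀ := hasDerivAt_pi.1 hγ 0
  have h₁ := hasDerivAt_pi.1 hγ 1
  have hd : γ t 1 - γ t 0 ≠ 0 := sub_ne_zero.2 hne.symm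
  refine HasDerivAt.congr_deriv (((hG.hasDerivAt.comp t h₀).sub (hΓ.hasDerivAt.comp t h₁)).div
    ((h₁.sub h₀).const_mul 4) (mul_ne_zero four_ne_zero hd)) ?_
  simp only [Function.comp_apply, Pi.sub_apply, quotientDensity]
  field_simp
  ring

theorem grad_quotientDensity (hG : ContDiffAt ℝ ∞ G (p 0)) (hΓ : ContDiffAt ℝ ∞ Γ (p 1))
    (hp : p 0 ≠ p 1) :
    grad (quotientDensity G Γ) p =
      ![deriv G (p 0) / (4 * (p 1 - p 0)) + quotientDensity G Γ p / (p 1 - p 0),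
        -(deriv Γ (p 1) / (4 * (p 1 - p 0)) + quotientDensity G Γ p / (p 1 - p 0))] := by
  have pderiv_eq (i : Fin 2) := pderiv_eq_of_hasDerivAt_update
    ((contDiffAt_quotientDensity hG hΓ hp).differentiableAt (by simp))
    (hasDerivAt_quotientDensity_comp (γ := Function.update p i)
      (by simpa using hG.differentiableAt (by simp)) (by simpa using hΓ.differentiableAt (by simp))
      (by simpa using hp) (hasDerivAt_update p i (p i)))
  ext i
  fin_cases i <;> simp [grad, pderiv_eq]

/-- The Hessian of `quotientDensity G Γ`, in terms of the density itself. -/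
noncomputable def quotientDensityHessian (G Γ : ℝ → ℝ) (p : Fin 2 → ℝ) :
    Matrix (Fin 2) (Fin 2) ℝ :=
  let d := p 1 - p 0
  let h := quotientDensity G Γ p
  let mixed := -((deriv G (p 0) + deriv Γ (p 1)) / (4 * d ^ 2) + 2 * h / d ^ 2)
  !![deriv (deriv G) (p 0) / (4 * d) + deriv G (p 0) / (2 * d ^ 2) + 2 * h / d ^ 2, mixed;
    mixed, -(deriv (deriv Γ) (p 1) / (4 * d)) + deriv Γ (p 1) / (2 * d ^ 2) + 2 * h / d ^ 2]

theorem hasDerivAt_grad_quotientDensity_comp (hG : ∀ t ∈ U, ContDiffAt ℝ ∞ G t)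
    (hΓ : ∀ t ∈ V, ContDiffAt ℝ ∞ Γ t) (hu : IsSmoothField (offDiagonal U V) u) (x : ℝ) :
    HasDerivAt (fun y => grad (quotientDensity G Γ) (u y))
      (quotientDensityHessian G Γ (u x) *ᵥ deriv u x) x := by
  have h₀ := hasDerivAt_coord hu.1 0 x
  have h₁ := hasDerivAt_coord hu.1 1 x
  obtain ⟨hxU, hxV, hne⟩ := hu.2 x
  have hd : u x 1 - u x 0 ≠ 0 := sub_ne_zero.2 hne.symm
  have hh := hasDerivAt_quotientDensity_comp ((hG _ hxU).differentiableAt (by simp))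
    ((hΓ _ hxV).differentiableAt (by simp)) hne (hu.1.differentiable (by simp) x).hasDerivAt
  have hG' := (hasDerivAt_of_contDiffAt (contDiffAt_deriv (hG _ hxU))).comp x h₀
  have hΓ' := (hasDerivAt_of_contDiffAt (contDiffAt_deriv (hΓ _ hxV))).comp x h₁
  have grad_eq (y : ℝ) := grad_quotientDensity (hG _ (hu.2 y).1) (hΓ _ (hu.2 y).2.1) (hu.2 y).2.2
  simp only [grad_eq]
  refine hasDerivAt_pi.2 (Fin.forall_fin_two.2 ⟨?_, ?_⟩)
  · refine HasDerivAt.congr_deriv ((hG'.fun_div ((h₁.fun_sub h₀).const_mul 4)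
      (mul_ne_zero four_ne_zero hd)).fun_add (hh.fun_div (h₁.fun_sub h₀) hd)) ?_
    simp only [Function.comp_apply, quotientDensityHessian, Matrix.mulVec, dotProduct,
      Fin.sum_univ_two, Matrix.of_apply, Matrix.cons_val', Matrix.cons_val_fin_one,
      Matrix.cons_val_zero, Matrix.cons_val_one]
    field_simp
    ring
  · refine HasDerivAt.congr_deriv ((hΓ'.fun_div ((h₁.fun_sub h₀).const_mul 4)
      (mul_ne_zero four_ne_zero hd)).fun_add (hh.fun_div (h₁.fun_sub h₀) hd)).fun_neg ?_
    simp only [Function.comp_apply, quotientDensityHessian, Matrix.mulVec, dotProduct,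
      Fin.sum_univ_two, Matrix.of_apply, Matrix.cons_val', Matrix.cons_val_fin_one,
      Matrix.cons_val_zero, Matrix.cons_val_one]
    field_simp
    ring

theorem hasDerivAt_speedPotential_comp (hf : ∀ t ∈ U, ContDiffAt ℝ ∞ f t)
    (hφ : ∀ t ∈ V, ContDiffAt ℝ ∞ φ t)
    (hG : ∀ t ∈ U, ContDiffAt ℝ ∞ G t) (hΓ : ∀ t ∈ V, ContDiffAt ℝ ∞ Γ t)
    (hG' : ∀ t ∈ U, f t * deriv (deriv G) t = 2 - deriv f t * deriv G t / 2)
    (hΓ' : ∀ t ∈ V, φ t * deriv (deriv Γ) t = 2 - deriv φ t * deriv Γ t / 2)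
    (hu : IsSmoothField (offDiagonal U V) u) (x : ℝ) :
    HasDerivAt (fun y => speedPotential f φ G Γ (u y))
      (speed₁ f φ (u x) * deriv u x 0 * grad (quotientDensity G Γ) (u x) 0 +
        speed₂ f φ (u x) * deriv u x 1 * grad (quotientDensity G Γ) (u x) 1) x := by
  have h₀ := hasDerivAt_coord hu.1 0 x
  have h₁ := hasDerivAt_coord hu.1 1 x
  obtain ⟨hxU, hxV, hne⟩ := hu.2 x
  have hd : u x 1 - u x 0 ≠ 0 := sub_ne_zero.2 hne.symm
  have hh := hasDerivAt_quotientDensity_comp ((hG _ hxU).differentiableAt (by simp))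
    ((hΓ _ hxV).differentiableAt (by simp)) hne (hu.1.differentiable (by simp) x).hasDerivAt
  have hfu := (hasDerivAt_of_contDiffAt (hf _ hxU)).comp x h₀
  have hφv := (hasDerivAt_of_contDiffAt (hφ _ hxV)).comp x h₁
  have hGu := (hasDerivAt_of_contDiffAt (contDiffAt_deriv (hG _ hxU))).comp x h₀
  have hΓv := (hasDerivAt_of_contDiffAt (contDiffAt_deriv (hΓ _ hxV))).comp x h₁
  refine HasDerivAt.congr_deriv ((((h₀.fun_add h₁).div_const 2).fun_sub
    (((hfu.fun_mul hGu).fun_add (hφv.fun_mul hΓv)).div_const 4)).fun_sub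
      (((hfu.fun_add hφv).div_const 2).fun_mul hh)) ?_
  rw [grad_quotientDensity (hG _ hxU) (hΓ _ hxV) hne]
  simp only [Function.comp_apply, speed₁, speed₂, Matrix.cons_val_zero, Matrix.cons_val_one]
  linear_combination (norm := (field_simp; ring))
    -deriv u x 0 / 4 * hG' _ hxU - deriv u x 1 / 4 * hΓ' _ hxV

theorem isHamiltonianSystem_quotientDensity
    (hf : ∀ t ∈ U, ContDiffAt ℝ ∞ f t) (hφ : ∀ t ∈ V, ContDiffAt ℝ ∞ φ t)
    (hG : ∀ t ∈ U, ContDiffAt ℝ ∞ G t) (hΓ : ∀ t ∈ V, ContDiffAt ℝ ∞ Γ t)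
    (hG' : ∀ t ∈ U, f t * deriv (deriv G) t = 2 - deriv f t * deriv G t / 2)
    (hΓ' : ∀ t ∈ V, φ t * deriv (deriv Γ) t = 2 - deriv φ t * deriv Γ t / 2) :
    IsHamiltonianSystem (offDiagonal U V) (chaplyginOperator f φ) (quotientDensity G Γ)
      chaplyginMatrix := by
  refine ⟨fun p hp => (contDiffAt_quotientDensity (hG _ hp.1) (hΓ _ hp.2.1)
    hp.2.2).contDiffWithinAt, ![quotientDensity G Γ, speedPotential f φ G Γ], fun u hu x => ?_⟩
  obtain ⟨hxU, hxV, hne⟩ := hu.2 x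
  have hd : u x 1 - u x 0 ≠ 0 := sub_ne_zero.2 hne.symm
  refine ⟨Fin.forall_fin_two.2 ⟨?_, ?_⟩, ?_⟩
  · refine HasDerivAt.congr_deriv (hasDerivAt_quotientDensity_comp
      ((hG _ hxU).differentiableAt (by simp)) ((hΓ _ hxV).differentiableAt (by simp)) hne
      (hu.1.differentiable (by simp) x).hasDerivAt) ?_
    simp only [grad_quotientDensity (hG _ hxU) (hΓ _ hxV) hne, chaplyginOperator,
      Matrix.mulVec, dotProduct, Fin.sum_univ_two, Matrix.of_apply, Matrix.cons_val',
      Matrix.cons_val_fin_one, Matrix.cons_val_zero, Matrix.cons_val_one]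
    ring
  · simpa [chaplyginOperator, Matrix.mulVec, dotProduct] using
      hasDerivAt_speedPotential_comp hf hφ hG hΓ hG' hΓ' hu x
  · rw [(hasDerivAt_grad_quotientDensity_comp hG hΓ hu x).deriv,
      grad_quotientDensity (hG _ hxU) (hΓ _ hxV) hne]
    refine funext (Fin.forall_fin_two.2 ⟨?_, ?_⟩)
    all_goals simp only [hydroFlow, chaplyginMatrix, chaplyginOperator, quotientDensityHessian,
      speedPotential, speed₁, speed₂, Pi.add_apply, Matrix.mulVec, dotProduct, Fin.sum_univ_two,
      Matrix.smul_apply, smul_eq_mul, Matrix.of_apply, Matrix.cons_val', Matrix.cons_val_fin_one,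
      Matrix.cons_val_zero, Matrix.cons_val_one]
    · linear_combination (norm := (field_simp; ring))
        (u x 0 - u x 1) / 4 * deriv u x 0 * hG' _ hxU
    · linear_combination (norm := (field_simp; ring))
        (u x 1 - u x 0) / 4 * deriv u x 1 * hΓ' _ hxV

theorem isHamiltonianSystem_chaplyginDensity {F Φ : ℝ → ℝ} (hU : IsOpen U) (hV : IsOpen V)
    (hf : Admissible U f) (hφ : Admissible V φ) (hF : IsRootPrimitive U f F)
    (hΦ : IsRootPrimitive V φ Φ) :
    IsHamiltonianSystem (offDiagonal U V) (chaplyginOperator f φ) (chaplyginDensity f φ F Φ)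
      chaplyginMatrix :=
  isHamiltonianSystem_quotientDensity (hf.contDiffAt hU) (hφ.contDiffAt hV)
    (hF.contDiffAt_sign_mul_sq hU hf) (hΦ.contDiffAt_sign_mul_sq hV hφ)
    (hF.deriv_deriv_sign_mul_sq hU hf) (hΦ.deriv_deriv_sign_mul_sq hV hφ)

end Density

section CommutingFlowClassification

theorem update_pair_zero (x y t : ℝ) : Function.update ![x, y] 0 t = ![t, y] := by
  ext i
  fin_cases i <;> simp

theorem update_pair_one (x y t : ℝ) : Function.update ![x, y] 1 t = ![x, t] := by
  ext i
  fin_cases i <;> simp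

variable {U V : Set ℝ} {w₁ w₂ z₁ z₂ : (Fin 2 → ℝ) → ℝ} {p : Fin 2 → ℝ}

theorem IsCommutingSpeed.sub {Ω : Set (Fin 2 → ℝ)} (hw : IsCommutingSpeed Ω w₁ w₂)
    (hz : IsCommutingSpeed Ω z₁ z₂) (hΩ : IsOpen Ω) (hw₁ : ContDiffOn ℝ ∞ w₁ Ω)
    (hw₂ : ContDiffOn ℝ ∞ w₂ Ω) (hz₁ : ContDiffOn ℝ ∞ z₁ Ω) (hz₂ : ContDiffOn ℝ ∞ z₂ Ω) :
    IsCommutingSpeed Ω (fun p => w₁ p - z₁ p) (fun p => w₂ p - z₂ p) := by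
  intro p hp
  rw [pderiv_sub (differentiableAt_of_contDiffOn hΩ hw₁ hp)
      (differentiableAt_of_contDiffOn hΩ hz₁ hp),
    pderiv_sub (differentiableAt_of_contDiffOn hΩ hw₂ hp)
      (differentiableAt_of_contDiffOn hΩ hz₂ hp)]
  constructor
  · linear_combination (hw p hp).1 - (hz p hp).1
  · linear_combination (hw p hp).2 - (hz p hp).2

theorem IsCommutingSpeed.mul_pderiv_zero_pderiv_one {Ω : Set (Fin 2 → ℝ)} (hΩ : IsOpen Ω)
    (hw : IsCommutingSpeed Ω w₁ w₂) (hw₁ : ContDiffOn ℝ ∞ w₁ Ω) (hw₂ : ContDiffOn ℝ ∞ w₂ Ω)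
    (hp : p ∈ Ω) (hne : p 0 ≠ p 1) :
    (p 0 - p 1) * pderiv 0 (pderiv 1 w₂) p = pderiv 1 w₂ p := by
  have hd : DifferentiableAt ℝ (fun q : Fin 2 → ℝ => q 0 - q 1) p := by fun_prop
  have pderiv_eq : pderiv 1 (fun q => (q 0 - q 1) * pderiv 0 w₂ q) p =
      pderiv 1 (fun q => w₂ q - w₁ q) p := by
    have : (fun q => (q 0 - q 1) * pderiv 0 w₂ q) =ᶠ[𝓝 p] fun q => w₂ q - w₁ q := by
      filter_upwards [hΩ.mem_nhds hp] with q hq using (hw q hq).2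
    rw [pderiv, this.fderiv_eq, pderiv]
  rw [pderiv_mul hd
    (differentiableAt_of_contDiffOn hΩ (contDiffOn_pderiv hΩ hw₂ 0) hp),
    pderiv_sub (differentiableAt_of_contDiffOn hΩ hw₂ hp)
      (differentiableAt_of_contDiffOn hΩ hw₁ hp),
    pderiv_sub (differentiableAt_apply _ _) (differentiableAt_apply _ _), pderiv_coord,
    pderiv_coord, pderiv_comm (hw₂.contDiffAt (hΩ.mem_nhds hp))] at pderiv_eq
  have pderiv_swap : pderiv 1 w₁ p = pderiv 0 w₂ p :=
    mul_left_cancel₀ (sub_ne_zero.2 hne) ((hw p hp).1.trans (hw p hp).2.symm)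
  simp only [Pi.single_eq_of_ne zero_ne_one, Pi.single_eq_same] at pderiv_eq
  linear_combination pderiv_eq - pderiv_swap

theorem mem_offDiagonal_iff (hUV : Disjoint U V) :
    p ∈ offDiagonal U V ↔ p 0 ∈ U ∧ p 1 ∈ V :=
  ⟨fun hp => ⟨hp.1, hp.2.1⟩, fun hp => ⟨hp.1, hp.2, hUV.ne_of_mem hp.1 hp.2⟩⟩

theorem IsCommutingSpeed.pderiv_one_eq_zero (hU : IsOpen U) (hV : IsOpen V)
    (hU' : U.OrdConnected) (hUV : Disjoint U V) (hw : IsCommutingSpeed (offDiagonal U V) w₁ w₂)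
    (hw₁ : ContDiffOn ℝ ∞ w₁ (offDiagonal U V)) (hw₂ : ContDiffOn ℝ ∞ w₂ (offDiagonal U V))
    {u₀ : ℝ} (hu₀ : u₀ ∈ U) (h₀ : ∀ p ∈ offDiagonal U V, p 0 = u₀ → w₂ p = 0)
    (hp : p ∈ offDiagonal U V) : pderiv 1 w₂ p = 0 := by
  have hΩ := isOpen_offDiagonal hU hV
  have mem_update (t : ℝ) (ht : t ∈ U) : Function.update p 0 t ∈ offDiagonal U V :=
    (mem_offDiagonal_iff hUV).2 (by simpa using ⟨ht, hp.2.1⟩)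
  have pderiv_zero_on_line : pderiv 1 w₂ (Function.update p 0 u₀) = 0 := by
    refine pderiv_eq_zero_of_eqOn_line hV
      (differentiableAt_of_contDiffOn hΩ hw₂ (mem_update u₀ hu₀)) (mem_update u₀ hu₀).2.1
      fun t ht => ?_
    exact h₀ _ ((mem_offDiagonal_iff hUV).2 (by simpa using ⟨hu₀, ht⟩)) (by simp)
  have hasDerivAt_pderiv_div (t : ℝ) (ht : t ∈ U) : HasDerivAt
      (fun t => pderiv 1 w₂ (Function.update p 0 t) / (t - p 1)) 0 t := by
    have hne : t - p 1 ≠ 0 := sub_ne_zero.2 (hUV.ne_of_mem ht hp.2.1)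
    have hq := hasDerivAt_comp_update (i := 0)
      (differentiableAt_of_contDiffOn hΩ (contDiffOn_pderiv hΩ hw₂ 1) (mem_update t ht))
    have hmul := hw.mul_pderiv_zero_pderiv_one hΩ hw₁ hw₂ (mem_update t ht) (mem_update t ht).2.2
    simp only [Function.update_idem, Function.update_self,
      Function.update_of_ne one_ne_zero] at hq hmul
    refine (hq.fun_div ((hasDerivAt_id t).sub_const (p 1)) hne).congr_deriv ?_
    rw [id, mul_one, mul_comm, hmul, sub_self, zero_div]
  have quotient_eq := hU.is_const_of_deriv_eq_zero hU'.isPreconnected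
    (fun t ht => (hasDerivAt_pderiv_div t ht).differentiableAt.differentiableWithinAt)
    (fun t ht => (hasDerivAt_pderiv_div t ht).deriv) hp.1 hu₀
  simpa [pderiv_zero_on_line, sub_ne_zero.2 hp.2.2] using quotient_eq

theorem IsCommutingSpeed.eq_zero_of_eq_zero_on_lines (hU : IsOpen U) (hV : IsOpen V)
    (hU' : U.OrdConnected) (hV' : V.OrdConnected) (hUV : Disjoint U V)
    (hw : IsCommutingSpeed (offDiagonal U V) w₁ w₂)
    (hw₁ : ContDiffOn ℝ ∞ w₁ (offDiagonal U V)) (hw₂ : ContDiffOn ℝ ∞ w₂ (offDiagonal U V))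
    {u₀ v₀ : ℝ} (hu₀ : u₀ ∈ U) (hv₀ : v₀ ∈ V)
    (h₁ : ∀ p ∈ offDiagonal U V, p 0 = u₀ → w₁ p = 0)
    (h₂ : ∀ p ∈ offDiagonal U V, p 1 = v₀ → w₂ p = 0) (hp : p ∈ offDiagonal U V) :
    w₁ p = 0 ∧ w₂ p = 0 := by
  have hΩ := isOpen_offDiagonal hU hV
  have mem_update_zero {q} (hq : q ∈ offDiagonal U V) {t : ℝ} (ht : t ∈ U) :
      Function.update q 0 t ∈ offDiagonal U V :=
    (mem_offDiagonal_iff hUV).2 (by simpa using ⟨ht, hq.2.1⟩)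
  have mem_update_one {q} (hq : q ∈ offDiagonal U V) {t : ℝ} (ht : t ∈ V) :
      Function.update q 1 t ∈ offDiagonal U V :=
    (mem_offDiagonal_iff hUV).2 (by simpa using ⟨hq.1, ht⟩)
  have w₂_eq_zero_on_line (q) (hq : q ∈ offDiagonal U V) (hq₀ : q 0 = u₀) : w₂ q = 0 := by
    have h := (hw q hq).1
    rw [pderiv_eq_zero_of_eqOn_line hV (differentiableAt_of_contDiffOn hΩ hw₁ hq) hq.2.1
      fun t ht => h₁ _ (mem_update_one hq ht) (by simpa using hq₀), h₁ q hq hq₀] at h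
    linarith
  have pderiv_one_eq_zero {q} (hq : q ∈ offDiagonal U V) : pderiv 1 w₂ q = 0 :=
    hw.pderiv_one_eq_zero hU hV hU' hUV hw₁ hw₂ hu₀ w₂_eq_zero_on_line hq
  have w₂_eq_zero {q} (hq : q ∈ offDiagonal U V) : w₂ q = 0 := by
    have h := apply_update_eq_of_pderiv_eq_zero (p := q) (i := 1) hV hV'
      (fun t ht => differentiableAt_of_contDiffOn hΩ hw₂ (mem_update_one hq ht))
      (fun t ht => pderiv_one_eq_zero (mem_update_one hq ht)) hq.2.1 hv₀
    rwa [Function.update_eq_self, h₂ _ (mem_update_one hq hv₀) (by simp)] at h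
  refine ⟨?_, w₂_eq_zero hp⟩
  have h := (hw p hp).2
  rw [pderiv_eq_zero_of_eqOn_line hU (differentiableAt_of_contDiffOn hΩ hw₂ hp) hp.1
    fun t ht => w₂_eq_zero (mem_update_zero hp ht), w₂_eq_zero hp] at h
  linarith

theorem contDiffOn_comp_pair_left {g : (Fin 2 → ℝ) → ℝ} (hUV : Disjoint U V)
    (hg : ContDiffOn ℝ ∞ g (offDiagonal U V)) {y : ℝ} (hy : y ∈ V) :
    ContDiffOn ℝ ∞ (fun x => g ![x, y]) U :=
  hg.comp (contDiff_pi.2 (Fin.forall_fin_two.2 ⟨contDiff_id, contDiff_const⟩)).contDiffOn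
    fun _ hx => (mem_offDiagonal_iff hUV).2 ⟨hx, hy⟩

theorem contDiffOn_comp_pair_right {g : (Fin 2 → ℝ) → ℝ} (hUV : Disjoint U V)
    (hg : ContDiffOn ℝ ∞ g (offDiagonal U V)) {x : ℝ} (hx : x ∈ U) :
    ContDiffOn ℝ ∞ (fun y => g ![x, y]) V :=
  hg.comp (contDiff_pi.2 (Fin.forall_fin_two.2 ⟨contDiff_const, contDiff_id⟩)).contDiffOn
    fun _ hy => (mem_offDiagonal_iff hUV).2 ⟨hx, hy⟩

theorem IsCommutingSpeed.exists_speed_eq_on_lines (hU : IsOpen U) (hV : IsOpen V)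
    (hUV : Disjoint U V) (hw : IsCommutingSpeed (offDiagonal U V) w₁ w₂)
    (hw₁ : ContDiffOn ℝ ∞ w₁ (offDiagonal U V)) (hw₂ : ContDiffOn ℝ ∞ w₂ (offDiagonal U V))
    {u₀ v₀ : ℝ} (hu₀ : u₀ ∈ U) (hv₀ : v₀ ∈ V) :
    ∃ f φ : ℝ → ℝ, ContDiffOn ℝ ∞ f U ∧ ContDiffOn ℝ ∞ φ V ∧
      (∀ p ∈ offDiagonal U V, p 0 = u₀ → w₁ p = speed₁ f φ p) ∧
      ∀ p ∈ offDiagonal U V, p 1 = v₀ → w₂ p = speed₂ f φ p := by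
  have hΩ := isOpen_offDiagonal hU hV
  have h_mem : ![u₀, v₀] ∈ offDiagonal U V := (mem_offDiagonal_iff hUV).2 ⟨hu₀, hv₀⟩
  -- The two conditions hold if `φ` vanishes to first order at `v₀`.
  let f : ℝ → ℝ := fun x => -2 * w₂ ![x, v₀]
  let φ : ℝ → ℝ := fun y => -2 * w₁ ![u₀, y] + (u₀ - y) * deriv f u₀ - f u₀
  have hf : ContDiffOn ℝ ∞ f U := contDiffOn_const.mul (contDiffOn_comp_pair_left hUV hw₂ hv₀)
  have hφ : ContDiffOn ℝ ∞ φ V :=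
    ((contDiffOn_const.mul (contDiffOn_comp_pair_right hUV hw₁ hu₀)).add
      ((contDiffOn_const.sub contDiffOn_id).mul contDiffOn_const)).sub contDiffOn_const
  have deriv_f : HasDerivAt f (-2 * pderiv 0 w₂ ![u₀, v₀]) u₀ := by
    simpa [f, update_pair_zero] using (hasDerivAt_comp_update
      (differentiableAt_of_contDiffOn hΩ hw₂ h_mem) 0).const_mul (-2)
  have deriv_w₁ : HasDerivAt (fun y => w₁ ![u₀, y]) (pderiv 1 w₁ ![u₀, v₀]) v₀ := by
    simpa [update_pair_one] using
      hasDerivAt_comp_update (differentiableAt_of_contDiffOn hΩ hw₁ h_mem) 1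
  have h := hw _ h_mem
  simp only [Matrix.cons_val_zero, Matrix.cons_val_one] at h
  have deriv_φ : HasDerivAt φ 0 v₀ := by
    refine (((deriv_w₁.const_mul (-2)).fun_add (((hasDerivAt_id v₀).const_sub u₀).mul_const
      (deriv f u₀))).sub_const (f u₀)).congr_deriv ?_
    have pderiv_eq := mul_left_cancel₀ (sub_ne_zero.2 h_mem.2.2) (h.1.trans h.2.symm)
    rw [deriv_f.deriv, pderiv_eq]
    ring
  have φ_eq_zero : φ v₀ = 0 := by
    simp only [φ, f, deriv_f.deriv]
    linear_combination -2 * h.2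
  refine ⟨f, φ, hf, hφ, fun p _ hp₀ => ?_, fun p _ hp₁ => ?_⟩
  · have hp_eq : p = ![u₀, p 1] := by ext i; fin_cases i; exacts [hp₀, rfl]
    rw [hp_eq]
    simp [speed₁, φ]
  · have hp_eq : p = ![p 0, v₀] := by ext i; fin_cases i; exacts [rfl, hp₁]
    rw [hp_eq]
    simp [speed₂, φ_eq_zero, deriv_φ.deriv, f]

theorem IsCommutingSpeed.exists_eq_speed (hU : IsOpen U) (hV : IsOpen V)
    (hU' : U.OrdConnected) (hV' : V.OrdConnected) (hU₀ : U.Nonempty) (hV₀ : V.Nonempty)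
    (hUV : Disjoint U V) (hw : IsCommutingSpeed (offDiagonal U V) w₁ w₂)
    (hw₁ : ContDiffOn ℝ ∞ w₁ (offDiagonal U V)) (hw₂ : ContDiffOn ℝ ∞ w₂ (offDiagonal U V)) :
    ∃ f φ : ℝ → ℝ, ContDiffOn ℝ ∞ f U ∧ ContDiffOn ℝ ∞ φ V ∧
      ∀ p ∈ offDiagonal U V, w₁ p = speed₁ f φ p ∧ w₂ p = speed₂ f φ p := by
  have hΩ := isOpen_offDiagonal hU hV
  obtain ⟨u₀, hu₀⟩ := hU₀
  obtain ⟨v₀, hv₀⟩ := hV₀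
  obtain ⟨f, φ, hf, hφ, h₁, h₂⟩ := hw.exists_speed_eq_on_lines hU hV hUV hw₁ hw₂ hu₀ hv₀
  have hf' (t) (ht : t ∈ U) := hf.contDiffAt (hU.mem_nhds ht)
  have hφ' (t) (ht : t ∈ V) := hφ.contDiffAt (hV.mem_nhds ht)
  have speed₁_smooth : ContDiffOn ℝ ∞ (speed₁ f φ) (offDiagonal U V) := fun p hp =>
    (contDiffAt_speed₁ (hf' _ hp.1) (hφ' _ hp.2.1)).contDiffWithinAt
  have speed₂_smooth : ContDiffOn ℝ ∞ (speed₂ f φ) (offDiagonal U V) := fun p hp =>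
    (contDiffAt_speed₂ (hf' _ hp.1) (hφ' _ hp.2.1)).contDiffWithinAt
  have hdiff := hw.sub (isCommutingSpeed_speed hf' hφ') hΩ hw₁ hw₂ speed₁_smooth speed₂_smooth
  refine ⟨f, φ, hf, hφ, fun p hp => ?_⟩
  have h := hdiff.eq_zero_of_eq_zero_on_lines hU hV hU' hV' hUV (hw₁.sub speed₁_smooth)
    (hw₂.sub speed₂_smooth) hu₀ hv₀ (fun q hq hq₀ => sub_eq_zero.2 (h₁ q hq hq₀))
    (fun q hq hq₁ => sub_eq_zero.2 (h₂ q hq hq₁)) hp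
  exact ⟨sub_eq_zero.1 h.1, sub_eq_zero.1 h.2⟩

theorem eq_diagonal_of_commute_diagonal {ι R : Type*} [Fintype ι] [DecidableEq ι] [CommRing R]
    [IsDomain R] {v : ι → R} (hv : Function.Injective v) {M : Matrix ι ι R}
    (h : Commute (Matrix.diagonal v) M) : M = Matrix.diagonal M.diag := by
  ext i j
  rcases eq_or_ne i j with rfl | hij
  · rw [Matrix.diagonal_apply_eq, Matrix.diag_apply]
  · have hM := congrFun₂ h.eq i j
    rw [Matrix.diagonal_mul, Matrix.mul_diagonal, mul_comm (M i j)] at hM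
    rw [Matrix.diagonal_apply_ne _ hij]
    by_contra hne
    exact hij (hv (mul_right_cancel₀ hne hM))

theorem FlowsCommute.exists_eq_speedMatrix (hU : IsOpen U) (hV : IsOpen V)
    (hU' : U.OrdConnected) (hV' : V.OrdConnected) (hU₀ : U.Nonempty) (hV₀ : V.Nonempty)
    (hUV : Disjoint U V) {W : (Fin 2 → ℝ) → Matrix (Fin 2) (Fin 2) ℝ}
    (hW : ∀ i j, ContDiffOn ℝ ∞ (fun p => W p i j) (offDiagonal U V))
    (h : FlowsCommute (offDiagonal U V) chaplyginMatrix W) :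
    ∃ f φ : ℝ → ℝ, ContDiffOn ℝ ∞ f U ∧ ContDiffOn ℝ ∞ φ V ∧
      ∀ p ∈ offDiagonal U V, W p = speedMatrix f φ p := by
  have hΩ := isOpen_offDiagonal hU hV
  have W_eq (p) (hp : p ∈ offDiagonal U V) : W p = Matrix.diagonal ![W p 0 0, W p 1 1] := by
    have hcomm := h.matrix_commute hΩ (fun i j p _ => by
      fin_cases i <;> fin_cases j
      exacts [differentiableAt_apply 1 p, differentiableAt_const 0, differentiableAt_const 0,
        differentiableAt_apply 0 p])
      (fun i j p hp => differentiableAt_of_contDiffOn hΩ (hW i j) hp) hp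
    rw [chaplyginMatrix_eq_diagonal] at hcomm
    have hinj : Function.Injective ![p 1, p 0] := by
      simpa [Function.Injective, Fin.forall_fin_two, eq_comm] using hp.2.2
    refine (eq_diagonal_of_commute_diagonal hinj hcomm).trans (congrArg _ (funext ?_))
    exact Fin.forall_fin_two.2 ⟨rfl, rfl⟩
  obtain ⟨f, φ, hf, hφ, hw⟩ := ((flowsCommute_chaplyginMatrix_diagonal_iff hU hV
    (fun p hp => differentiableAt_of_contDiffOn hΩ (hW 0 0) hp)
    (fun p hp => differentiableAt_of_contDiffOn hΩ (hW 1 1) hp)).1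
      (h.congr_right hΩ W_eq)).exists_eq_speed hU hV hU' hV' hU₀ hV₀ hUV (hW 0 0) (hW 1 1)
  refine ⟨f, φ, hf, hφ, fun p hp => ?_⟩
  rw [W_eq p hp, (hw p hp).1, (hw p hp).2, speedMatrix_eq_diagonal]

end CommutingFlowClassification

section Locality

theorem eqOn_zero_of_integral_test_mul_eq_zero {s : Set ℝ} (hs : IsOpen s) {g : ℝ → ℝ}
    (hg : Continuous g)
    (h : ∀ χ : ℝ → ℝ, ContDiff ℝ ∞ χ → HasCompactSupport χ → tsupport χ ⊆ s →
      ∫ x, χ x * g x = 0) : Set.EqOn g 0 s := by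
  have hae := hs.ae_eq_zero_of_integral_contDiff_smul_eq_zero
    (hg.locallyIntegrable.locallyIntegrableOn s) (μ := volume) h
  exact Measure.eqOn_open_of_ae_eq ((ae_restrict_iff' hs.measurableSet).2 hae) hs
    hg.continuousOn continuousOn_const

theorem invD_eq_of_support_subset_Ioi {g : ℝ → ℝ} {x : ℝ} (hg : Function.support g ⊆ Set.Ioi x) :
    invD g x = -(1 / 2) * ∫ y, g y := by
  have integral_Iic : ∫ y in Set.Iic x, g y = 0 :=
    setIntegral_eq_zero_of_forall_eq_zero fun y hy =>
      Function.notMem_support.1 fun h => absurd (hg h) (Set.notMem_Ioi.2 hy)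
  have integral_Ioi : ∫ y in Set.Ioi x, g y = ∫ y, g y :=
    setIntegral_eq_integral_of_forall_compl_eq_zero fun y hy =>
      Function.notMem_support.1 fun h => hy (hg h)
  rw [invD, integral_Iic, integral_Ioi]
  ring

theorem exists_isSmoothField_loop {n : ℕ} {Ω : Set (Fin n → ℝ)} (hΩ : IsOpen Ω) {p : Fin n → ℝ}
    (hp : p ∈ Ω) : ∃ u T, IsSmoothField Ω u ∧ 0 < T ∧ u 0 = p ∧ u T = p ∧
      ∀ i, deriv u 0 i ≠ 0 ∧ deriv u T i ≠ 0 := by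
  obtain ⟨r, hr, hball⟩ := Metric.isOpen_iff.1 hΩ p hp
  let u : ℝ → Fin n → ℝ := fun x i => p i + r / 2 * Real.sin x
  have hu : ContDiff ℝ ∞ u := contDiff_pi.2 fun i => by fun_prop
  have deriv_u (x : ℝ) (i : Fin n) : deriv u x i = r / 2 * Real.cos x :=
    (hasDerivAt_coord hu i x).unique (((Real.hasDerivAt_sin x).const_mul (r / 2)).const_add (p i))
  refine ⟨u, 2 * Real.pi, ⟨hu, fun x => hball ?_⟩, Real.two_pi_pos, ?_, ?_, fun i => ?_⟩
  · refine (dist_pi_lt_iff hr).2 fun i => ?_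
    rw [Real.dist_eq, add_sub_cancel_left, abs_mul, abs_of_pos (half_pos hr)]
    nlinarith [Real.abs_sin_le_one x]
  · simp [u]
  · simp [u]
  · simp [deriv_u, hr.ne']

variable {U V : Set ℝ} {f φ : ℝ → ℝ} {u : ℝ → Fin 2 → ℝ} {x : ℝ}

theorem continuous_speedMatrix_comp (hf : ∀ t ∈ U, ContDiffAt ℝ ∞ f t)
    (hφ : ∀ t ∈ V, ContDiffAt ℝ ∞ φ t) (hu : IsSmoothField (offDiagonal U V) u) (i : Fin 2) :
    Continuous fun y => speedMatrix f φ (u y) i i := by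
  refine continuous_iff_continuousAt.2 fun y => ?_
  have h₁ := contDiffAt_speed₁ (hf _ (hu.2 y).1) (hφ _ (hu.2 y).2.1)
  have h₂ := contDiffAt_speed₂ (hf _ (hu.2 y).1) (hφ _ (hu.2 y).2.1)
  fin_cases i
  exacts [(h₁.comp y hu.1.contDiffAt).continuousAt, (h₂.comp y hu.1.contDiffAt).continuousAt]

theorem chaplyginOperator_apply_of_eventuallyEq_zero {a : ℝ → Fin 2 → ℝ} (ha : a =ᶠ[𝓝 x] 0)
    (i : Fin 2) : (chaplyginOperator f φ).toFieldOperator u a x i =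
      deriv u x i * (speedMatrix f φ (u x) i i * invD (translationFlux u a) x +
        invD (speedFlux f φ u a) x) := by
  have deriv_a : deriv a x = 0 := by rw [ha.deriv_eq]; exact deriv_const x 0
  fin_cases i <;>
    simp only [Fin.zero_eta, Fin.mk_one, chaplyginOperator_apply_zero, chaplyginOperator_apply_one,
      deriv_a, ha.eq_of_nhds, Pi.zero_apply, speedMatrix, Matrix.of_apply, Matrix.cons_val',
      Matrix.cons_val_zero, Matrix.cons_val_one, Matrix.cons_val_fin_one] <;>
    ring

theorem single_comp_eventuallyEq_zero {χ : ℝ → ℝ} (hχ : tsupport χ ⊆ Set.Ioi x) (i : Fin 2) :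
    (fun y => Pi.single i (χ y)) =ᶠ[𝓝 x] (0 : ℝ → Fin 2 → ℝ) := by
  filter_upwards [notMem_tsupport_iff_eventuallyEq.1 fun h => lt_irrefl x (hχ h)] with y hy
  simp [hy]

theorem chaplyginOperator_apply_single_of_tsupport_subset_Ioi (hf : ∀ t ∈ U, ContDiffAt ℝ ∞ f t)
    (hφ : ∀ t ∈ V, ContDiffAt ℝ ∞ φ t) (hu : IsSmoothField (offDiagonal U V) u) {χ : ℝ → ℝ}
    (hχ : Continuous χ) (hχc : HasCompactSupport χ) (hχx : tsupport χ ⊆ Set.Ioi x) (i : Fin 2) :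
    (chaplyginOperator f φ).toFieldOperator u (fun y => Pi.single i (χ y)) x i =
      -(1 / 2) * deriv u x i * ∫ y, χ y *
        ((speedMatrix f φ (u x) i i + speedMatrix f φ (u y) i i) * deriv u y i) := by
  have translationFlux_eq : translationFlux u (fun y => Pi.single i (χ y)) =
      fun y => deriv u y i * χ y := by
    ext y
    fin_cases i <;> simp [translationFlux]
  have speedFlux_eq : speedFlux f φ u (fun y => Pi.single i (χ y)) =
      fun y => speedMatrix f φ (u y) i i * deriv u y i * χ y := by
    ext y
    fin_cases i <;> simp [speedFlux, speedMatrix]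
  have support_subset (g : ℝ → ℝ) : Function.support (fun y => g y * χ y) ⊆ Set.Ioi x :=
    (Function.support_mul_subset_right _ _).trans ((subset_tsupport χ).trans hχx)
  have integrable_mul {g : ℝ → ℝ} (hg : Continuous g) : Integrable fun y => g y * χ y :=
    (hg.mul hχ).integrable_of_hasCompactSupport hχc.mul_left
  have continuous_deriv : Continuous fun y => deriv u y i :=
    (continuous_apply i).comp (hu.1.continuous_deriv (by simp))
  have continuous_speed_mul : Continuous fun y => speedMatrix f φ (u y) i i * deriv u y i :=
    (continuous_speedMatrix_comp hf hφ hu i).mul continuous_deriv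
  rw [chaplyginOperator_apply_of_eventuallyEq_zero (single_comp_eventuallyEq_zero hχx i),
    translationFlux_eq, speedFlux_eq, invD_eq_of_support_subset_Ioi (support_subset _),
    invD_eq_of_support_subset_Ioi (support_subset _)]
  have integral_eq : ∫ y, χ y *
        ((speedMatrix f φ (u x) i i + speedMatrix f φ (u y) i i) * deriv u y i) =
      speedMatrix f φ (u x) i i * (∫ y, deriv u y i * χ y) +
        ∫ y, speedMatrix f φ (u y) i i * deriv u y i * χ y := by
    rw [← integral_const_mul, ← integral_add ((integrable_mul continuous_deriv).const_mul _)
      (integrable_mul continuous_speed_mul)]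
    congr with y
    ring
  rw [integral_eq]
  ring

theorem speedMatrix_add_mul_eq_zero_of_isLocalOperator (hf : ∀ t ∈ U, ContDiffAt ℝ ∞ f t)
    (hφ : ∀ t ∈ V, ContDiffAt ℝ ∞ φ t)
    (h : IsLocalOperator (offDiagonal U V) (chaplyginOperator f φ).toFieldOperator)
    (hu : IsSmoothField (offDiagonal U V) u) (i : Fin 2) (hx : deriv u x i ≠ 0) {y : ℝ}
    (hxy : x < y) :
    (speedMatrix f φ (u x) i i + speedMatrix f φ (u y) i i) * deriv u y i = 0 := by
  refine eqOn_zero_of_integral_test_mul_eq_zero isOpen_Ioi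
    (g := fun y => (speedMatrix f φ (u x) i i + speedMatrix f φ (u y) i i) * deriv u y i)
    ((continuous_const.add (continuous_speedMatrix_comp hf hφ hu i)).mul
      ((continuous_apply i).comp (hu.1.continuous_deriv (by simp)))) (fun χ hχ hχc hχx => ?_) hxy
  have ha : IsTestCovector fun y => (Pi.single i (χ y) : Fin 2 → ℝ) :=
    ⟨(ContinuousLinearMap.single ℝ (fun _ : Fin 2 => ℝ) i).contDiff.comp hχ,
      hχc.comp_left (Pi.single_zero i)⟩
  have happly := congrFun (h u _ x hu ha (single_comp_eventuallyEq_zero hχx i)) i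
  rw [chaplyginOperator_apply_single_of_tsupport_subset_Ioi hf hφ hu hχ.continuous hχc hχx]
    at happly
  exact (mul_eq_zero.1 happly).resolve_left (mul_ne_zero (by norm_num) hx)

theorem isLocalOperator_chaplyginOperator_iff (hU : IsOpen U) (hV : IsOpen V)
    (hf : ∀ t ∈ U, ContDiffAt ℝ ∞ f t) (hφ : ∀ t ∈ V, ContDiffAt ℝ ∞ φ t) :
    IsLocalOperator (offDiagonal U V) (chaplyginOperator f φ).toFieldOperator ↔
      ∀ p ∈ offDiagonal U V, speed₁ f φ p = 0 ∧ speed₂ f φ p = 0 := by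
  refine ⟨fun h p hp => ?_, fun h u a x hu _ ha => ?_⟩
  · obtain ⟨u, T, hu, hT, hu₀, huT, hderiv⟩ :=
      exists_isSmoothField_loop (isOpen_offDiagonal hU hV) hp
    have speed_eq_zero (i : Fin 2) : speedMatrix f φ p i i = 0 := by
      have hsum := (mul_eq_zero.1 (speedMatrix_add_mul_eq_zero_of_isLocalOperator hf hφ h hu i
        (hderiv i).1 hT)).resolve_right (hderiv i).2
      rwa [hu₀, huT, add_self_eq_zero] at hsum
    exact ⟨speed_eq_zero 0, speed_eq_zero 1⟩
  · have speedFlux_eq : speedFlux f φ u a = 0 := by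
      ext y
      simp [speedFlux, h _ (hu.2 y)]
    have speedMatrix_eq (i : Fin 2) : speedMatrix f φ (u x) i i = 0 := by
      fin_cases i
      exacts [(h _ (hu.2 x)).1, (h _ (hu.2 x)).2]
    ext i
    rw [chaplyginOperator_apply_of_eventuallyEq_zero ha, speedFlux_eq, speedMatrix_eq]
    simp [invD]

end Locality

section Distinctness

variable {U V : Set ℝ} {f₁ φ₁ f₂ φ₂ : ℝ → ℝ}

theorem lead_eq_of_sameOperatorOn
    (h : SameOperatorOn (offDiagonal U V) (chaplyginOperator f₁ φ₁).toFieldOperator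
      (chaplyginOperator f₂ φ₂).toFieldOperator) {p : Fin 2 → ℝ} (hp : p ∈ offDiagonal U V) :
    f₁ (p 0) = f₂ (p 0) ∧ φ₁ (p 1) = φ₂ (p 1) := by
  -- On a constant field only the leading term is left.
  obtain ⟨a, ha, ha₀⟩ := exists_isTestCovector_eventuallyEq
    (X := fun x : ℝ => (fun _ => x : Fin 2 → ℝ)) (by fun_prop) (isCompact_singleton (x := 0))
  have deriv_a (i : Fin 2) : deriv a 0 i = 1 := by
    rw [(ha₀ 0 rfl).deriv_eq]
    exact congrFun (hasDerivAt_pi.2 fun _ => hasDerivAt_id (0 : ℝ)).deriv i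
  have hJ (i : Fin 2) := congrFun (congrFun (h (fun _ => p) a ⟨contDiff_const, fun _ => hp⟩ ha) 0) i
  have hd : p 0 - p 1 ≠ 0 := sub_ne_zero.2 hp.2.2
  exact ⟨by simpa [chaplyginOperator_apply_zero, deriv_a, hd] using hJ 0,
    by simpa [chaplyginOperator_apply_one, deriv_a, hd] using hJ 1⟩

theorem eqOn_of_sameOperatorOn (hU : IsOpen U) (hV : IsOpen V) (hU₀ : U.Nonempty)
    (hV₀ : V.Nonempty)
    (h : SameOperatorOn (offDiagonal U V) (chaplyginOperator f₁ φ₁).toFieldOperator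
      (chaplyginOperator f₂ φ₂).toFieldOperator) : Set.EqOn f₁ f₂ U ∧ Set.EqOn φ₁ φ₂ V := by
  refine ⟨fun t ht => ?_, fun t ht => ?_⟩
  · obtain ⟨s, hst, hs⟩ := (dense_compl_singleton t).exists_mem_open hV hV₀
    exact (lead_eq_of_sameOperatorOn h (p := ![t, s]) ⟨ht, hs, Ne.symm hst⟩).1
  · obtain ⟨s, hst, hs⟩ := (dense_compl_singleton t).exists_mem_open hU hU₀
    exact (lead_eq_of_sameOperatorOn h (p := ![s, t]) ⟨hs, ht, hst⟩).2

theorem exists_infinitely_many_nonlocal (hU : IsOpen U) (hV : IsOpen V) (hU₀ : U.Nonempty)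
    (hV₀ : V.Nonempty) : ∃ f φ : ℕ → ℝ → ℝ,
      (∀ k, Admissible U (f k) ∧ Admissible V (φ k) ∧
        ¬ IsLocalOperator (offDiagonal U V) (chaplyginOperator (f k) (φ k)).toFieldOperator) ∧
      ∀ k l, k ≠ l → ¬ SameOperatorOn (offDiagonal U V)
        (chaplyginOperator (f k) (φ k)).toFieldOperator
        (chaplyginOperator (f l) (φ l)).toFieldOperator := by
  obtain ⟨t, ht⟩ := hU₀
  obtain ⟨s, hst, hs⟩ := (dense_compl_singleton t).exists_mem_open hV hV₀
  have hp : ![t, s] ∈ offDiagonal U V := ⟨ht, hs, Ne.symm hst⟩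
  refine ⟨fun k _ => k + 1, fun _ _ => 1, fun k => ⟨⟨contDiffOn_const, fun t _ => by positivity⟩,
    ⟨contDiffOn_const, fun t _ => one_ne_zero⟩, fun h => ?_⟩, fun k l hkl h => hkl ?_⟩
  · have speed_eq_zero := ((isLocalOperator_chaplyginOperator_iff hU hV
      (fun _ _ => contDiffAt_const) (fun _ _ => contDiffAt_const)).1 h _ hp).1
    simp only [speed₁, deriv_const] at speed_eq_zero
    linarith [(k.cast_nonneg : (0 : ℝ) ≤ k)]
  · simpa using (lead_eq_of_sameOperatorOn h hp).1

end Distinctness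

theorem mainTheorem5 (U V : Set ℝ) (hU : IsOpen U) (hV : IsOpen V)
    (hU' : U.OrdConnected) (hV' : V.OrdConnected) (hU₀ : U.Nonempty) (hV₀ : V.Nonempty) :
    -- each pair `f`, `φ` gives a nonlocal Hamiltonian structure of the system
    (∀ f φ : ℝ → ℝ, Admissible U f → Admissible V φ →
      LocalPartOfMetric (offDiagonal U V) (chaplyginOperator f φ) (chaplyginMetric f φ) ∧
      IsHamiltonianOperator (offDiagonal U V) (chaplyginOperator f φ).toFieldOperator ∧
      FlowsCommute (offDiagonal U V) chaplyginMatrix (speedMatrix f φ) ∧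
      (∀ F Φ : ℝ → ℝ, IsRootPrimitive U f F → IsRootPrimitive V φ Φ →
        IsHamiltonianSystem (offDiagonal U V) (chaplyginOperator f φ)
          (chaplyginDensity f φ F Φ) chaplyginMatrix) ∧
      (IsLocalOperator (offDiagonal U V) (chaplyginOperator f φ).toFieldOperator ↔
        ∀ p ∈ offDiagonal U V, speed₁ f φ p = 0 ∧ speed₂ f φ p = 0)) ∧
    -- all these structures are mutually compatible
    (∀ f₁ φ₁ f₂ φ₂ : ℝ → ℝ, Admissible U f₁ → Admissible V φ₁ →
      Admissible U f₂ → Admissible V φ₂ →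
      Compatible (offDiagonal U V) (chaplyginOperator f₁ φ₁).toFieldOperator
        (chaplyginOperator f₂ φ₂).toFieldOperator) ∧
    -- different pairs of functions give different operators
    (∀ f₁ φ₁ f₂ φ₂ : ℝ → ℝ, Admissible U f₁ → Admissible V φ₁ →
      Admissible U f₂ → Admissible V φ₂ →
      SameOperatorOn (offDiagonal U V) (chaplyginOperator f₁ φ₁).toFieldOperator
        (chaplyginOperator f₂ φ₂).toFieldOperator →
      Set.EqOn f₁ f₂ U ∧ Set.EqOn φ₁ φ₂ V) ∧
    -- infinitely many of the operators are nonlocal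
    (∃ f φ : ℕ → ℝ → ℝ,
      (∀ k, Admissible U (f k) ∧ Admissible V (φ k) ∧
        ¬ IsLocalOperator (offDiagonal U V) (chaplyginOperator (f k) (φ k)).toFieldOperator) ∧
      ∀ k l, k ≠ l → ¬ SameOperatorOn (offDiagonal U V)
        (chaplyginOperator (f k) (φ k)).toFieldOperator
        (chaplyginOperator (f l) (φ l)).toFieldOperator) ∧
    -- the speeds `w¹`, `w²` give the general commuting flow of hydrodynamic type
    (Disjoint U V → ∀ W : (Fin 2 → ℝ) → Matrix (Fin 2) (Fin 2) ℝ,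
      (∀ i j, ContDiffOn ℝ ∞ (fun p => W p i j) (offDiagonal U V)) →
      FlowsCommute (offDiagonal U V) chaplyginMatrix W →
      ∃ f φ : ℝ → ℝ, ContDiffOn ℝ ∞ f U ∧ ContDiffOn ℝ ∞ φ V ∧
        ∀ p ∈ offDiagonal U V, W p = speedMatrix f φ p) := by
  refine ⟨fun f φ hf hφ => ?_, fun f₁ φ₁ f₂ φ₂ hf₁ hφ₁ hf₂ hφ₂ =>
    compatible_chaplyginOperator hU hV (hf₁.contDiffAt hU) (hφ₁.contDiffAt hV)
      (hf₂.contDiffAt hU) (hφ₂.contDiffAt hV),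
    fun f₁ φ₁ f₂ φ₂ _ _ _ _ h => eqOn_of_sameOperatorOn hU hV hU₀ hV₀ h,
    exists_infinitely_many_nonlocal hU hV hU₀ hV₀,
    fun hUV W hW h => h.exists_eq_speedMatrix hU hV hU' hV' hU₀ hV₀ hUV hW⟩
  have hf' := hf.contDiffAt hU
  have hφ' := hφ.contDiffAt hV
  exact ⟨localPartOfMetric_chaplyginOperator hU hV hf hφ,
    isHamiltonianOperator_chaplyginOperator hU hV hf' hφ',
    flowsCommute_chaplyginMatrix_speedMatrix hU hV hf' hφ',
    fun F Φ hF hΦ => isHamiltonianSystem_chaplyginDensity hU hV hf hφ hF hΦ,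
    isLocalOperator_chaplyginOperator_iff hU hV hf' hφ'⟩
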